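/- Theorem 11.3 (Lagrange inversion, polytopal version). For $n\ge 1$ let $\mathfrak a_n\subset\mathbb R^n$ be the standard Loday associahedron, that is, the Minkowski sum $$\mathfrak a_n=\sum_{1\le i\le j\le n}\Delta_{[i,j]},\qquad \Delta_{[i,j]}=\operatorname{conv}\{e_i,e_{i+1},\dots,e_j\}.$$ The polytope $\mathfrak a_n$ has finitely many faces. For every nonempty face $F$ of $\mathfrak a_n$ there are positive integers $f_1,\dots,f_k$, unique up to order, such that $F\cong\mathfrak a_{f_1}\times\cdots\times\mathfrak a_{f_k}$, where $\cong$ means that, after a bijective renaming of the coordinates, the two polytopes have the same normal fan (in particular $f_1+\cdots+f_k=n$). Let $K$ be a field of characteristic $0$ and $c_1,c_2,\dots\in K$. For a face $F\cong\mathfrak a_{f_1}\times\cdots\times\mathfrak a_{f_k}$ write $c_F=c_{f_1}\cdots c_{f_k}$. Then the compositional inverse of $$C(x)=x+c_1x^2+c_2x^3+\cdots$$ exists, is unique, and equals $$D(x)=x+d_1x^2+d_2x^3+\cdots,\qquad d_n=\sum_{F}(-1)^{n-\dim F}\,c_F\quad(n\ge 1),$$ where the sum is over all nonempty faces $F$ of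 $\mathfrak a_n$, including $\mathfrak a_n$ itself. (A compositional inverse of $C$ is a power series $D$ without constant term such that $C(D(x))=D(C(x))=x$.) -/

import Mathlib

open scoped Pointwise

noncomputable section

/-- The face `P_y` of `P ⊆ ℝ^I` on which the direction `y` is maximal over `P`. -/
def maxFace {I : Type*} [Fintype I] (P : Set (I → ℝ)) (y : I → ℝ) : Set (I → ℝ) :=
  {p | p ∈ P ∧ ∀ q ∈ P, y ⬝ᵥ q ≤ y ⬝ᵥ p}

/-- The set of nonempty faces of `P` (including `P` itself when `P` is nonempty: take `y = 0`). -/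
def nonemptyFaces {I : Type*} [Fintype I] (P : Set (I → ℝ)) : Set (Set (I → ℝ)) :=
  {F | F.Nonempty ∧ ∃ y : I → ℝ, F = maxFace P y}

/-- The closed normal cone of `P` at `F`: all directions `y` such that `F` is a face of `P_y`. -/
def normalCone {I : Type*} [Fintype I] (P F : Set (I → ℝ)) : Set (I → ℝ) :=
  {y | F ∈ nonemptyFaces (maxFace P y)}

/-- The normal fan of `P`, as the collection of the normal cones at its nonempty faces. -/
def normalFan {I : Type*} [Fintype I] (P : Set (I → ℝ)) : Set (Set (I → ℝ)) :=
  normalCone P '' nonemptyFaces P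

/-- Transport of a subset of `ℝ^J` to `ℝ^I` along the bijection `e : J ≃ I`, that is, its image
under the linear map sending the basis vector `e_j` to `e_{e j}`. -/
def relabel {I J : Type*} (e : J ≃ I) (Q : Set (J → ℝ)) : Set (I → ℝ) :=
  {x | (fun j => x (e j)) ∈ Q}

/-- `P ⊆ ℝ^I` and `Q ⊆ ℝ^J` are quasinormally equivalent: after some bijective renaming of the
coordinates they have the same normal fan. -/
def QuasinormallyEquivalent {I J : Type*} [Fintype I] [Fintype J]
    (P : Set (I → ℝ)) (Q : Set (J → ℝ)) : Prop :=
  ∃ e : J ≃ I, normalFan P = normalFan (relabel e Q)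

/-- The simplex `Δ_J = conv {e_j : j ∈ J} ⊆ ℝ^I`. -/
def coordSimplex {I : Type*} [DecidableEq I] (J : Set I) : Set (I → ℝ) :=
  convexHull ℝ ((fun j => (Pi.single j 1 : I → ℝ)) '' J)

/-- Loday's associahedron of a finite linearly ordered set `I`: the Minkowski sum of the simplices
`Δ_[i,j]` over all intervals `[i,j]`, `i ≤ j`. -/
def lodayAssociahedron (I : Type*) [Fintype I] [LinearOrder I] : Set (I → ℝ) :=
  ∑ q ∈ (Finset.univ : Finset (I × I)).filter (fun q => q.1 ≤ q.2),
    coordSimplex (Set.Icc q.1 q.2)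

/-- The standard Loday associahedron `𝔞_n ⊆ ℝ^n`. -/
def stdAssociahedron (n : ℕ) : Set (Fin n → ℝ) := lodayAssociahedron (Fin n)

/-- The product `𝔞_{f_1} × ⋯ × 𝔞_{f_k}`, in the space whose coordinates are the disjoint union of
those of the factors. -/
def associahedronProduct {k : ℕ} (f : Fin k → ℕ) : Set ((Σ i : Fin k, Fin (f i)) → ℝ) :=
  {x | ∀ i : Fin k, (fun j : Fin (f i) => x ⟨i, j⟩) ∈ stdAssociahedron (f i)}

/-- `F ≅ 𝔞_{f_1} × ⋯ × 𝔞_{f_k}`, where `p` is the multiset of the positive integers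
`f_1, …, f_k`. -/
def HasAssociahedralType {n : ℕ} (F : Set (Fin n → ℝ)) (p : Multiset ℕ) : Prop :=
  ∃ (k : ℕ) (f : Fin k → ℕ), (∀ i, 1 ≤ f i) ∧ Multiset.map f Finset.univ.val = p ∧
    QuasinormallyEquivalent F (associahedronProduct f)

open Classical in
/-- The multiset `{f_1, …, f_k}` with `F ≅ 𝔞_{f_1} × ⋯ × 𝔞_{f_k}`, if there is one. -/
def associahedralType {n : ℕ} (F : Set (Fin n → ℝ)) : Multiset ℕ :=
  if h : ∃ p, HasAssociahedralType F p then h.choose else 0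

/-- `c_F = c_{f_1} ⋯ c_{f_k}` for `F ≅ 𝔞_{f_1} × ⋯ × 𝔞_{f_k}`. -/
def faceCoeff {K : Type*} [CommRing K] (c : ℕ → K) {n : ℕ} (F : Set (Fin n → ℝ)) : K :=
  ((associahedralType F).map c).prod

/-- The dimension of (the affine hull of) a set in `ℝ^I`. -/
def faceDim {I : Type*} [Fintype I] (F : Set (I → ℝ)) : ℕ :=
  Module.finrank ℝ (vectorSpan ℝ F)

/-- The sum of `(-1)^(n - dim F) c_F` over the nonempty faces `F` of `𝔞_n`. -/
def associahedronFaceSum {K : Type*} [CommRing K] (c : ℕ → K) (n : ℕ) : K :=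
  ∑ᶠ F ∈ nonemptyFaces (stdAssociahedron n), (-1) ^ (n - faceDim F) * faceCoeff c F

/-- The power series `x + c₁ x² + c₂ x³ + ⋯`; the value `c 0` is not used. -/
def tangentSeries {K : Type*} [CommRing K] (c : ℕ → K) : PowerSeries K :=
  PowerSeries.mk fun m => if m = 0 then 0 else if m = 1 then 1 else c (m - 1)

/-- `D` is a compositional inverse of `C`: neither has a constant term, and
`C(D(x)) = x = D(C(x))`. -/
def IsCompositionalInverse {K : Type*} [CommRing K] (C D : PowerSeries K) : Prop :=
  PowerSeries.constantCoeff C = 0 ∧ PowerSeries.constantCoeff D = 0 ∧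
    PowerSeries.subst D C = PowerSeries.X ∧ PowerSeries.subst C D = PowerSeries.X

end

/-! A direction `y` is maximized over a Minkowski sum summand by summand, and over `Δ_J` exactly on
the simplex of the maximizers of `y` in `J`. So a face of `𝔞_n` is again a sum of coordinate
simplices, one for each set of maxima of `y` over an interval. Put two positions in one block if
each attains the maximum of `y` over the interval between them. The sets of maxima are then exactly
the intervals inside blocks (`image_argmaxSet_Icc`). Since the normal fan of a sum of simplices
depends only on which simplices occur, the face is of the type of a product of associahedra, one per
block. The intersection of all normal cones consists of the functions constant on blocks; it
determines the block sizes, and its dimension is the codimension of the face. Each block therefore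
contributes a factor `-c` of its size.

Faces correspond to dominance relations (`maxFace_stdAssociahedron_eq_iff`). Let `S_f = relSum c f`
be their weighted count with top block of size `f` and that block's factor removed, and let `S_0`
count all of them. Cutting at the first maximum gives `S_{f+1} = x S_0 S_f` as generating functions
(`relSum_succ_succ`), so `D = x S_0` satisfies `D^{f+1} = x S_f`. Sorting by the size of the top
block gives `S_0 = 1 - ∑ c_f S_f`, summed over `f ≥ 1` (`relSum_zero_eq`). Hence `C(D) = D + ∑ c_f
D^{f+1} = x`, and a right inverse must equal the two-sided inverse. -/

noncomputable section

/-! ### Faces and normal fans of sums of coordinate simplices -/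

section SimplexSums

variable {I α : Type*}

/-- The elements of `J` at which `y` is maximal over `J`. -/
def argmaxSet (J : Set I) (y : I → ℝ) : Set I := {j | j ∈ J ∧ ∀ k ∈ J, y k ≤ y j}

lemma argmaxSet_subset (J : Set I) (y : I → ℝ) : argmaxSet J y ⊆ J := fun _ h => h.1

lemma argmaxSet_zero (J : Set I) : argmaxSet J (0 : I → ℝ) = J := by
  ext j; simp [argmaxSet]

lemma argmaxSet_eq_self_iff {J : Set I} {y : I → ℝ} :
    argmaxSet J y = J ↔ ∀ i ∈ J, ∀ j ∈ J, y i = y j := by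
  constructor
  · intro h i hi j hj
    rw [← h] at hi hj
    exact le_antisymm (hj.2 i hi.1) (hi.2 j hj.1)
  · intro h
    ext j
    exact ⟨fun hj => hj.1, fun hj => ⟨hj, fun k hk => (h k hk j hj).le⟩⟩

lemma argmaxSet_nonempty [Finite I] {J : Set I} (hJ : J.Nonempty) (y : I → ℝ) :
    (argmaxSet J y).Nonempty := by
  obtain ⟨j, hj, h⟩ := Set.exists_max_image J y (Set.toFinite J) hJ
  exact ⟨j, hj, h⟩

lemma sum_set_nonempty {s : Finset α} {P : α → Set (I → ℝ)} (h : ∀ a ∈ s, (P a).Nonempty) :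
    (∑ a ∈ s, P a).Nonempty := by
  choose! f hf using h
  exact ⟨∑ a ∈ s, f a, Set.finsetSum_mem_finsetSum _ _ _ hf⟩

section Faces

variable [Fintype I]

lemma maxFace_zero_set (y : I → ℝ) : maxFace (0 : Set (I → ℝ)) y = 0 := by
  ext p
  simp only [maxFace, Set.mem_zero, Set.mem_ofPred_eq]
  constructor
  · exact fun h => h.1
  · rintro rfl
    exact ⟨rfl, fun q hq => by rw [hq]⟩

/-- Either summand can be varied with the other held fixed. This applies to every decomposition of a
maximal point, which is what later permits cancelling a summand. -/
lemma mem_maxFace_add {A B : Set (I → ℝ)} {y a b : I → ℝ} (ha : a ∈ A) (hb : b ∈ B) :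
    a + b ∈ maxFace (A + B) y ↔ a ∈ maxFace A y ∧ b ∈ maxFace B y := by
  constructor
  · rintro ⟨-, h⟩
    refine ⟨⟨ha, fun q hq => ?_⟩, ⟨hb, fun q hq => ?_⟩⟩
    · have := h (q + b) (Set.add_mem_add hq hb)
      simpa [dotProduct_add] using this
    · have := h (a + q) (Set.add_mem_add ha hq)
      simpa [dotProduct_add] using this
  · rintro ⟨⟨_, h1⟩, ⟨_, h2⟩⟩
    refine ⟨Set.add_mem_add ha hb, ?_⟩
    rintro _ ⟨p, hp, q, hq, rfl⟩
    simp only [dotProduct_add]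
    exact add_le_add (h1 p hp) (h2 q hq)

lemma maxFace_add (A B : Set (I → ℝ)) (y : I → ℝ) :
    maxFace (A + B) y = maxFace A y + maxFace B y := by
  ext p
  constructor
  · intro h
    obtain ⟨a, ha, b, hb, rfl⟩ := h.1
    obtain ⟨h1, h2⟩ := (mem_maxFace_add ha hb).1 h
    exact Set.add_mem_add h1 h2
  · rintro ⟨a, ha, b, hb, rfl⟩
    exact (mem_maxFace_add ha.1 hb.1).2 ⟨ha, hb⟩

lemma maxFace_sum (s : Finset α) (P : α → Set (I → ℝ)) (y : I → ℝ) :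
    maxFace (∑ a ∈ s, P a) y = ∑ a ∈ s, maxFace (P a) y := by
  classical
  induction s using Finset.induction_on with
  | empty => simpa using maxFace_zero_set y
  | insert a s ha ih => rw [Finset.sum_insert ha, Finset.sum_insert ha, maxFace_add, ih]

/-- Faces of Minkowski sums can be compared summandwise. -/
lemma maxFace_left_of_maxFace_add {A B : Set (I → ℝ)} {z z' w : I → ℝ}
    (hB : (maxFace B z).Nonempty) (hB' : (maxFace (maxFace B z') w).Nonempty)
    (h : maxFace (A + B) z = maxFace (maxFace (A + B) z') w) :
    maxFace A z = maxFace (maxFace A z') w := by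
  ext a
  constructor
  · intro ha
    -- A fixed maximal point of `B` lifts `a` to `A + B`, where the hypothesis applies;
    -- `mem_maxFace_add` then projects back to `a`.
    obtain ⟨b, hb⟩ := hB
    have h1 : a + b ∈ maxFace (maxFace (A + B) z') w := by
      rw [← h]; exact (mem_maxFace_add ha.1 hb.1).2 ⟨ha, hb⟩
    have h2 := (mem_maxFace_add ha.1 hb.1).1 h1.1
    rw [maxFace_add] at h1
    exact ((mem_maxFace_add h2.1 h2.2).1 h1).1
  · intro ha
    obtain ⟨b, hb⟩ := hB'
    have h1 : a + b ∈ maxFace (maxFace (A + B) z') w := by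
      rw [maxFace_add, maxFace_add]; exact Set.add_mem_add ha hb
    rw [← h] at h1
    exact ((mem_maxFace_add ha.1.1 hb.1.1).1 h1).1

/-! ### Coordinate simplices and their Minkowski sums -/

variable [DecidableEq I]

lemma mem_coordSimplex {J : Set I} {x : I → ℝ} :
    x ∈ coordSimplex J ↔ (∀ i, 0 ≤ x i) ∧ (∀ i, i ∉ J → x i = 0) ∧ ∑ i, x i = 1 := by
  constructor
  · intro hx
    have hconv : Convex ℝ {x : I → ℝ | (∀ i, 0 ≤ x i) ∧ (∀ i, i ∉ J → x i = 0) ∧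
        ∑ i, x i = 1} := by
      rintro u ⟨hu1, hu2, hu3⟩ v ⟨hv1, hv2, hv3⟩ a b ha hb hab
      refine ⟨fun i => ?_, fun i hi => ?_, ?_⟩
      · exact add_nonneg (mul_nonneg ha (hu1 i)) (mul_nonneg hb (hv1 i))
      · simp [hu2 i hi, hv2 i hi]
      · simp only [Pi.add_apply, Pi.smul_apply, smul_eq_mul, Finset.sum_add_distrib,
          ← Finset.mul_sum, hu3, hv3, mul_one, hab]
    refine convexHull_min ?_ hconv hx
    rintro _ ⟨j, hj, rfl⟩
    refine ⟨fun i => ?_, fun i hi => ?_, by simp⟩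
    · by_cases h : i = j <;> simp [h]
    · exact Pi.single_eq_of_ne (by rintro rfl; exact hi hj) _
  · rintro ⟨h1, h2, h3⟩
    classical
    have hx : x = ∑ i ∈ Finset.univ.filter (· ∈ J), x i • (Pi.single i 1 : I → ℝ) := by
      ext j
      rw [Finset.sum_filter, Finset.sum_apply, Finset.sum_eq_single j]
      · by_cases h : j ∈ J <;> simp [h, h2]
      · intro b _ hb
        by_cases h : b ∈ J <;> simp [h, hb.symm]
      · simp
    rw [hx]
    refine (convex_convexHull ℝ _).sum_mem (fun i _ => h1 i) ?_ ?_
    · rw [Finset.sum_filter, ← h3]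
      refine Finset.sum_congr rfl fun i _ => ?_
      by_cases h : i ∈ J <;> simp [h, h2]
    · intro i hi
      exact subset_convexHull ℝ _ ⟨i, (Finset.mem_filter.1 hi).2, rfl⟩

lemma single_mem_coordSimplex {J : Set I} {j : I} :
    (Pi.single j 1 : I → ℝ) ∈ coordSimplex J ↔ j ∈ J := by
  constructor
  · intro h
    by_contra hj
    simpa using (mem_coordSimplex.1 h).2.1 j hj
  · exact fun h => subset_convexHull ℝ _ ⟨j, h, rfl⟩

lemma coordSimplex_injective :
    Function.Injective (coordSimplex : Set I → Set (I → ℝ)) := by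
  intro J J' h
  ext j
  rw [← single_mem_coordSimplex, h, single_mem_coordSimplex]

lemma coordSimplex_nonempty {J : Set I} (h : J.Nonempty) :
    (coordSimplex J : Set (I → ℝ)).Nonempty :=
  ⟨_, single_mem_coordSimplex.2 h.choose_spec⟩

/-- The value of `y` at a point of the simplex is an average of its values on `J`, so it is maximal
only if all weight lies on maximizers. -/
lemma maxFace_coordSimplex (J : Set I) (y : I → ℝ) :
    maxFace (coordSimplex J) y = coordSimplex (argmaxSet J y) := by
  ext x
  constructor
  · rintro ⟨hx, hmax⟩
    obtain ⟨h1, h2, h3⟩ := mem_coordSimplex.1 hx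
    refine mem_coordSimplex.2 ⟨h1, fun i hi => ?_, h3⟩
    by_cases hJ : i ∈ J
    · obtain ⟨m, hm, hm'⟩ := argmaxSet_nonempty ⟨i, hJ⟩ y
      have hle : y m ≤ ∑ i, y i * x i := by
        have : y m ≤ y ⬝ᵥ x := by simpa using hmax _ (single_mem_coordSimplex.2 hm)
        exact this
      have hterm : ∀ k ∈ Finset.univ, 0 ≤ (y m - y k) * x k := by
        intro k _
        by_cases hk : k ∈ J
        · exact mul_nonneg (sub_nonneg.2 (hm' k hk)) (h1 k)
        · simp [h2 k hk]
      have hsum : ∑ k, (y m - y k) * x k = 0 := by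
        refine le_antisymm ?_ (Finset.sum_nonneg hterm)
        simp only [sub_mul, Finset.sum_sub_distrib, ← Finset.mul_sum, h3]
        linarith
      have := (Finset.sum_eq_zero_iff_of_nonneg hterm).1 hsum i (Finset.mem_univ i)
      rcases mul_eq_zero.1 this with h | h
      · exact absurd ⟨hJ, fun k hk => (hm' k hk).trans (by linarith)⟩ hi
      · exact h
    · exact h2 i hJ
  · intro hx
    obtain ⟨h1, h2, h3⟩ := mem_coordSimplex.1 hx
    refine ⟨mem_coordSimplex.2 ⟨h1, fun i hi => h2 i fun h => hi h.1, h3⟩, fun q hq => ?_⟩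
    obtain ⟨q1, q2, q3⟩ := mem_coordSimplex.1 hq
    -- Otherwise all coordinates of `x` vanish, although they sum to 1.
    have hne : (argmaxSet J y).Nonempty := by
      by_contra h
      rw [Set.not_nonempty_iff_eq_empty] at h
      simp [h] at h2
      simp [h2] at h3
    obtain ⟨m, hm⟩ := hne
    have e1 : y ⬝ᵥ x = y m := by
      have : ∀ i, y i * x i = y m * x i := by
        intro i
        by_cases hi : i ∈ argmaxSet J y
        · rw [le_antisymm (hm.2 i hi.1) (hi.2 m hm.1)]
        · simp [h2 i hi]
      simp only [dotProduct, this, ← Finset.mul_sum, h3, mul_one]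
    rw [e1]
    calc y ⬝ᵥ q ≤ ∑ i, y m * q i := by
          refine Finset.sum_le_sum fun i _ => ?_
          by_cases hi : i ∈ J
          · exact mul_le_mul_of_nonneg_right (hm.2 i hi) (q1 i)
          · simp [q2 i hi]
      _ = y m := by rw [← Finset.mul_sum, q3, mul_one]

/-- The Minkowski sum of the coordinate simplices `Δ_{J a}`, `a ∈ s`. -/
def simplexSum (s : Finset α) (J : α → Set I) : Set (I → ℝ) := ∑ a ∈ s, coordSimplex (J a)

lemma maxFace_simplexSum (s : Finset α) (J : α → Set I) (y : I → ℝ) :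
    maxFace (simplexSum s J) y = simplexSum s fun a => argmaxSet (J a) y := by
  simp only [simplexSum, maxFace_sum, maxFace_coordSimplex]

variable {s : Finset α} {J : α → Set I}

lemma simplexSum_nonempty (hJ : ∀ a ∈ s, (J a).Nonempty) : (simplexSum s J).Nonempty :=
  sum_set_nonempty fun a ha => coordSimplex_nonempty (hJ a ha)

lemma maxFace_simplexSum_nonempty (hJ : ∀ a ∈ s, (J a).Nonempty) (y : I → ℝ) :
    (maxFace (simplexSum s J) y).Nonempty := by
  rw [maxFace_simplexSum]
  exact simplexSum_nonempty fun a ha => argmaxSet_nonempty (hJ a ha) y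

lemma nonemptyFaces_simplexSum (hJ : ∀ a ∈ s, (J a).Nonempty) :
    nonemptyFaces (simplexSum s J) = Set.range (maxFace (simplexSum s J)) := by
  ext F
  constructor
  · rintro ⟨-, y, rfl⟩
    exact ⟨y, rfl⟩
  · rintro ⟨y, rfl⟩
    exact ⟨maxFace_simplexSum_nonempty hJ y, y, rfl⟩

lemma finite_nonemptyFaces_simplexSum : (nonemptyFaces (simplexSum s J)).Finite := by
  refine (Set.finite_range fun K : s → Set I => ∑ a : s, coordSimplex (K a)).subset ?_
  rintro _ ⟨-, y, rfl⟩
  refine ⟨fun a => argmaxSet (J a) y, ?_⟩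
  rw [maxFace_simplexSum, simplexSum]
  exact Finset.sum_coe_sort s fun a => coordSimplex (argmaxSet (J a) y)

/-- Cancelling all summands but one leaves an equality of coordinate simplices, and a simplex
determines its vertex set. This makes the defining condition of normal cones combinatorial. -/
lemma maxFace_eq_maxFace_maxFace_iff (hJ : ∀ a ∈ s, (J a).Nonempty) (z z' w : I → ℝ) :
    maxFace (simplexSum s J) z = maxFace (maxFace (simplexSum s J) z') w ↔
      ∀ a ∈ s, argmaxSet (J a) z = argmaxSet (argmaxSet (J a) z') w := by
  classical
  constructor
  · intro h a ha
    have hJ' : ∀ b ∈ s.erase a, (J b).Nonempty := fun b hb => hJ b (Finset.mem_of_mem_erase hb)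
    have hsum : simplexSum s J = coordSimplex (J a) + simplexSum (s.erase a) J :=
      (Finset.add_sum_erase s _ ha).symm
    rw [hsum] at h
    have := maxFace_left_of_maxFace_add (maxFace_simplexSum_nonempty hJ' z)
      (by
        rw [maxFace_simplexSum]
        exact maxFace_simplexSum_nonempty (fun b hb => argmaxSet_nonempty (hJ' b hb) z') w) h
    simp only [maxFace_coordSimplex] at this
    exact coordSimplex_injective this
  · intro h
    simp only [maxFace_simplexSum]
    exact Finset.sum_congr rfl fun a ha => congrArg coordSimplex (h a ha)

lemma maxFace_simplexSum_eq_iff (hJ : ∀ a ∈ s, (J a).Nonempty) (z z' : I → ℝ) :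
    maxFace (simplexSum s J) z = maxFace (simplexSum s J) z' ↔
      ∀ a ∈ s, argmaxSet (J a) z = argmaxSet (J a) z' := by
  have := maxFace_eq_maxFace_maxFace_iff hJ z z' 0
  have h0 : maxFace (maxFace (simplexSum s J) z') 0 = maxFace (simplexSum s J) z' := by
    simp [maxFace]
  simpa only [h0, argmaxSet_zero] using this

/-- The right side sees only the set `J '' s`, so the indexing and the multiplicities of the
simplices do not matter. -/
lemma normalFan_simplexSum (hJ : ∀ a ∈ s, (J a).Nonempty) :
    normalFan (simplexSum s J) = Set.range fun z : I → ℝ =>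
      {z' | ∃ w, ∀ A ∈ J '' s, argmaxSet A z = argmaxSet (argmaxSet A z') w} := by
  have key : ∀ z, normalCone (simplexSum s J) (maxFace (simplexSum s J) z) =
      {z' | ∃ w, ∀ A ∈ J '' s, argmaxSet A z = argmaxSet (argmaxSet A z') w} := by
    intro z
    ext z'
    simp only [normalCone, nonemptyFaces, Set.mem_ofPred_eq, Set.forall_mem_image, Finset.mem_coe,
      maxFace_eq_maxFace_maxFace_iff hJ]
    exact and_iff_right (maxFace_simplexSum_nonempty hJ z)
  rw [normalFan, nonemptyFaces_simplexSum hJ, ← Set.range_comp]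
  exact congrArg Set.range (funext key)

/-- The normal fan of a sum of simplices depends only on which simplices occur. -/
lemma normalFan_simplexSum_congr {β : Type*} {t : Finset β} {K : β → Set I}
    (hJ : ∀ a ∈ s, (J a).Nonempty) (h : J '' s = K '' t) :
    normalFan (simplexSum s J) = normalFan (simplexSum t K) := by
  have hK : ∀ b ∈ t, (K b).Nonempty := by
    intro b hb
    have : K b ∈ J '' s := h ▸ ⟨b, hb, rfl⟩
    obtain ⟨a, ha, hab⟩ := this
    exact hab ▸ hJ a ha
  rw [normalFan_simplexSum hJ, normalFan_simplexSum hK, h]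

lemma sInter_normalFan_simplexSum (hJ : ∀ a ∈ s, (J a).Nonempty) :
    ⋂₀ normalFan (simplexSum s J) = {y | ∀ a ∈ s, ∀ i ∈ J a, ∀ j ∈ J a, y i = y j} := by
  rw [normalFan_simplexSum hJ]
  ext y
  simp only [Set.sInter_range, Set.mem_iInter, Set.mem_ofPred_eq, Set.forall_mem_image,
    Finset.mem_coe, ← argmaxSet_eq_self_iff]
  constructor
  · intro h a ha
    -- The direction `0` gives the normal cone of the whole polytope, the smallest cone of the fan.
    obtain ⟨w, hw⟩ := h 0
    refine (argmaxSet_subset _ _).antisymm ?_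
    have := hw ha
    rw [argmaxSet_zero] at this
    exact this.subset.trans (argmaxSet_subset _ _)
  · exact fun h z => ⟨z, fun a ha => by rw [h a ha]⟩

/-- Exchanging one vertex of a single summand for another moves a point of the sum by this vector.
-/
lemma single_sub_single_mem_vectorSpan (hJ : ∀ a ∈ s, (J a).Nonempty) {a : α} (ha : a ∈ s)
    {i j : I} (hi : i ∈ J a) (hj : j ∈ J a) :
    (Pi.single i 1 - Pi.single j 1 : I → ℝ) ∈ vectorSpan ℝ (simplexSum s J) := by
  classical
  have hJ' : ∀ b ∈ s.erase a, (J b).Nonempty := fun b hb => hJ b (Finset.mem_of_mem_erase hb)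
  have hsum : simplexSum s J = coordSimplex (J a) + simplexSum (s.erase a) J :=
    (Finset.add_sum_erase s _ ha).symm
  obtain ⟨p, hp⟩ := simplexSum_nonempty hJ'
  have := vsub_mem_vectorSpan ℝ
    (hsum ▸ Set.add_mem_add (single_mem_coordSimplex.2 hi) hp :
      Pi.single i 1 + p ∈ simplexSum s J)
    (hsum ▸ Set.add_mem_add (single_mem_coordSimplex.2 hj) hp :
      Pi.single j 1 + p ∈ simplexSum s J)
  simpa using this

/-- The directions which are constant on a sum of simplices. -/
lemma forall_mem_vectorSpan_dotProduct_eq_zero_iff (hJ : ∀ a ∈ s, (J a).Nonempty) (y : I → ℝ) :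
    (∀ v ∈ vectorSpan ℝ (simplexSum s J), y ⬝ᵥ v = 0) ↔
      y ∈ ⋂₀ normalFan (simplexSum s J) := by
  rw [sInter_normalFan_simplexSum hJ]
  constructor
  · intro h a ha i hi j hj
    have := h _ (single_sub_single_mem_vectorSpan hJ ha hi hj)
    simpa [dotProduct_sub, sub_eq_zero] using this
  · intro h v hv
    have hface : maxFace (simplexSum s J) y = simplexSum s J := by
      rw [maxFace_simplexSum, simplexSum, simplexSum]
      exact Finset.sum_congr rfl fun a ha => by rw [argmaxSet_eq_self_iff.2 (h a ha)]
    have hle : vectorSpan ℝ (simplexSum s J) ≤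
        LinearMap.ker (dotProductEquiv ℝ I y) := by
      rw [vectorSpan_def, Submodule.span_le]
      rintro _ ⟨p, hp, q, hq, rfl⟩
      rw [← hface] at hp hq
      have := le_antisymm (hp.2 q hq.1) (hq.2 p hp.1)
      simp [dotProduct_sub, this]
    simpa using hle hv

end Faces

end SimplexSums

/-! ### The associahedron and products of associahedra as sums of simplices -/

lemma stdAssociahedron_eq_simplexSum (n : ℕ) :
    stdAssociahedron n = simplexSum ((Finset.univ : Finset (Fin n × Fin n)).filter
      fun q => q.1 ≤ q.2) fun q => Set.Icc q.1 q.2 := rfl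

lemma Icc_nonempty_of_mem_filter {n : ℕ} : ∀ q ∈ (Finset.univ : Finset (Fin n × Fin n)).filter
    (fun q => q.1 ≤ q.2), (Set.Icc q.1 q.2).Nonempty := by
  intro q hq
  exact Set.nonempty_Icc.2 (Finset.mem_filter.1 hq).2

lemma extendByZero_image_coordSimplex {I J : Type*} [DecidableEq I] [DecidableEq J] {s : J → I}
    (hs : Function.Injective s) (A : Set J) :
    Function.ExtendByZero.linearMap ℝ s '' (coordSimplex A) = coordSimplex (s '' A) := by
  rw [coordSimplex, coordSimplex, LinearMap.image_convexHull, Set.image_image, Set.image_image]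
  congr 1
  refine Set.image_congr fun j _ => ?_
  ext i
  change Function.extend s (Pi.single j 1) 0 i = _
  by_cases h : ∃ a, s a = i
  · obtain ⟨a, rfl⟩ := h
    rw [hs.extend_apply]
    by_cases hj : a = j
    · subst hj; simp
    · rw [Pi.single_eq_of_ne hj, Pi.single_eq_of_ne (fun h => hj (hs h))]
  · rw [Function.extend_apply' _ _ _ h, Pi.single_eq_of_ne (fun hi => h ⟨j, hi.symm⟩)]
    rfl

/-- The intervals in the blocks of `Σ i, Fin (f i)`. -/
def blockIntervals {k : ℕ} (f : Fin k → ℕ) : Finset (Σ i : Fin k, Fin (f i) × Fin (f i)) :=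
  Finset.univ.sigma fun _ => Finset.univ.filter fun q => q.1 ≤ q.2

/-- A product over complementary sets of coordinates is the Minkowski sum of its factors extended by
zero. -/
lemma relabel_associahedronProduct {I : Type*} [Fintype I] [DecidableEq I] {k : ℕ}
    (f : Fin k → ℕ) (e : (Σ i : Fin k, Fin (f i)) ≃ I) :
    relabel e (associahedronProduct f) =
      simplexSum (blockIntervals f) fun q => (fun j => e ⟨q.1, j⟩) '' Set.Icc q.2.1 q.2.2 := by
  have hinj : ∀ i, Function.Injective fun j => e ⟨i, j⟩ := fun i a b h => by
    simpa using e.injective h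
  rw [simplexSum, blockIntervals, Finset.sum_sigma]
  have hsum : ∀ i, (∑ q ∈ (Finset.univ : Finset (Fin (f i) × Fin (f i))).filter
      (fun q => q.1 ≤ q.2), coordSimplex ((fun j => e ⟨i, j⟩) '' Set.Icc q.1 q.2)) =
      Function.ExtendByZero.linearMap ℝ (fun j => e ⟨i, j⟩) '' stdAssociahedron (f i) := by
    intro i
    rw [stdAssociahedron_eq_simplexSum, simplexSum, Set.image_finsetSum]
    exact Finset.sum_congr rfl fun q _ => (extendByZero_image_coordSimplex (hinj i) _).symm
  simp only [hsum]
  have hext : ∀ (v : ∀ i, Fin (f i) → ℝ) (i : Fin k) (j : Fin (f i)),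
      (∑ i', Function.ExtendByZero.linearMap ℝ (fun j => e ⟨i', j⟩) (v i')) (e ⟨i, j⟩) = v i j := by
    intro v i j
    rw [Finset.sum_apply, Finset.sum_eq_single i]
    · exact (hinj i).extend_apply _ _ _
    · intro b _ hb
      refine Function.extend_apply' _ _ _ ?_
      rintro ⟨a, ha⟩
      exact hb (congrArg Sigma.fst (e.injective ha))
    · simp
  ext x
  rw [Set.mem_finsetSum]
  constructor
  · intro hx
    refine ⟨fun i => Function.ExtendByZero.linearMap ℝ (fun j => e ⟨i, j⟩)
      fun j => x (e ⟨i, j⟩), fun {i} _ => ⟨_, hx i, rfl⟩, ?_⟩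
    ext b
    obtain ⟨⟨i, j⟩, rfl⟩ := e.surjective b
    exact hext (fun i j => x (e ⟨i, j⟩)) i j
  · rintro ⟨g, hg, rfl⟩ i
    choose v hv hvg using fun i => hg (Finset.mem_univ i)
    simp only [← hvg, hext]
    exact hv i

lemma mem_blockIntervals {k : ℕ} {f : Fin k → ℕ} {q : Σ i : Fin k, Fin (f i) × Fin (f i)} :
    q ∈ blockIntervals f ↔ q.2.1 ≤ q.2.2 := by
  simp [blockIntervals]

lemma blockIntervals_image_nonempty {I : Type*} {k : ℕ} {f : Fin k → ℕ}
    (e : (Σ i : Fin k, Fin (f i)) ≃ I) :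
    ∀ q ∈ blockIntervals f, ((fun j => e ⟨q.1, j⟩) '' Set.Icc q.2.1 q.2.2).Nonempty :=
  fun _ hq => (Set.nonempty_Icc.2 (mem_blockIntervals.1 hq)).image _

lemma mem_sInter_normalFan_relabel {I : Type*} [Fintype I] {k : ℕ}
    {f : Fin k → ℕ} (e : (Σ i : Fin k, Fin (f i)) ≃ I) (y : I → ℝ) :
    y ∈ ⋂₀ normalFan (relabel e (associahedronProduct f)) ↔
      ∀ i a b, y (e ⟨i, a⟩) = y (e ⟨i, b⟩) := by
  classical
  rw [relabel_associahedronProduct, sInter_normalFan_simplexSum (blockIntervals_image_nonempty e)]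
  constructor
  · intro h i a b
    exact h ⟨i, min a b, max a b⟩ (mem_blockIntervals.2 min_le_max) _
      ⟨a, by simp, rfl⟩ _ ⟨b, by simp, rfl⟩
  · rintro h ⟨i, q⟩ _ _ ⟨a, _, rfl⟩ _ ⟨b, _, rfl⟩
    exact h i a b

/-! ### Block sizes and dimension from the normal fan -/

lemma fst_symm_eq_iff {I : Type*} [Fintype I] {k : ℕ}
    {f : Fin k → ℕ} (e : (Σ i : Fin k, Fin (f i)) ≃ I) (i j : I) :
    (e.symm i).1 = (e.symm j).1 ↔
      ∀ y ∈ ⋂₀ normalFan (relabel e (associahedronProduct f)), y i = y j := by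
  constructor
  · intro h y hy
    rw [mem_sInter_normalFan_relabel] at hy
    obtain ⟨⟨a, a'⟩, rfl⟩ := e.surjective i
    obtain ⟨⟨b, b'⟩, rfl⟩ := e.surjective j
    simp only [Equiv.symm_apply_apply] at h
    subst h
    exact hy _ _ _
  · intro h
    by_contra hne
    -- The indicator function of the block of `i` is constant on blocks and separates `i` from `j`.
    have := h (fun x => if (e.symm x).1 = (e.symm i).1 then 1 else 0)
      ((mem_sInter_normalFan_relabel e _).2 fun _ _ _ => by simp)
    simp [Ne.symm hne] at this

/-- The sizes of the blocks are determined by the normal fan. -/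
lemma map_univ_eq_of_normalFan_eq {I : Type*} [Fintype I] {k k' : ℕ}
    {f : Fin k → ℕ} {f' : Fin k' → ℕ} (hf : ∀ i, 1 ≤ f i) (hf' : ∀ i, 1 ≤ f' i)
    (e : (Σ i : Fin k, Fin (f i)) ≃ I) (e' : (Σ i : Fin k', Fin (f' i)) ≃ I)
    (h : normalFan (relabel e (associahedronProduct f)) =
      normalFan (relabel e' (associahedronProduct f'))) :
    Multiset.map f Finset.univ.val = Multiset.map f' Finset.univ.val := by
  classical
  have hker : ∀ i j, (e.symm i).1 = (e.symm j).1 ↔ (e'.symm i).1 = (e'.symm j).1 := by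
    intro i j
    rw [fst_symm_eq_iff, fst_symm_eq_iff, h]
  have card_fiber : ∀ {k : ℕ} {f : Fin k → ℕ} (e : (Σ i : Fin k, Fin (f i)) ≃ I) (i : Fin k),
      (Finset.univ.filter fun x => (e.symm x).1 = i).card = f i := by
    intro k f e i
    have : (Finset.univ.filter fun x => (e.symm x).1 = i) = (Finset.univ : Finset (Fin (f i))).map
        ⟨fun j => e ⟨i, j⟩, fun a b h => by simpa using e.injective h⟩ := by
      ext x
      obtain ⟨⟨a, b⟩, rfl⟩ := e.surjective x
      simp only [Equiv.symm_apply_apply, Finset.mem_filter, Finset.mem_univ, true_and,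
        Finset.mem_map]
      constructor
      · rintro rfl
        exact ⟨b, rfl⟩
      · rintro ⟨c, hc⟩
        exact (congrArg Sigma.fst (e.injective hc)).symm
    rw [this, Finset.card_map, Finset.card_univ, Fintype.card_fin]
  -- Both decompositions induce the same partition of `I`, so following the first element of each
  -- block matches the blocks.
  let g : Fin k → Fin k' := fun i => (e'.symm (e ⟨i, ⟨0, hf i⟩⟩)).1
  have hg : ∀ x, g (e.symm x).1 = (e'.symm x).1 := by
    intro x
    rw [← hker]
    simp
  have hbij : Function.Bijective g := by
    constructor
    · intro i j hij
      have := (hker _ _).2 hij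
      simpa using this
    · intro i
      exact ⟨(e.symm (e' ⟨i, ⟨0, hf' i⟩⟩)).1, by rw [hg]; simp⟩
  have hfg : ∀ i, f i = f' (g i) := by
    intro i
    rw [← card_fiber e, ← card_fiber e']
    congr 1
    ext x
    simp only [Finset.mem_filter, Finset.mem_univ, true_and]
    rw [← hg, hbij.1.eq_iff]
  have : f = f' ∘ Equiv.ofBijective g hbij := funext hfg
  rw [this, ← Multiset.map_map]
  congr 1
  exact congrArg Finset.val (Finset.map_univ_equiv (Equiv.ofBijective g hbij))

/-- The annihilator of the direction space consists of the functions constant on blocks, a copy of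
`ℝ^k`. -/
lemma faceDim_add_card {I α : Type*} [Fintype I] [DecidableEq I] {s : Finset α} {J : α → Set I}
    (hJ : ∀ a ∈ s, (J a).Nonempty) {k : ℕ} {f : Fin k → ℕ} (hf : ∀ i, 1 ≤ f i)
    (e : (Σ i : Fin k, Fin (f i)) ≃ I)
    (h : normalFan (simplexSum s J) = normalFan (relabel e (associahedronProduct f))) :
    faceDim (simplexSum s J) + k = Fintype.card I := by
  have hsurj : Function.Surjective fun x => (e.symm x).1 :=
    fun i => ⟨e ⟨i, ⟨0, hf i⟩⟩, by simp⟩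
  have key : (vectorSpan ℝ (simplexSum s J)).dualAnnihilator =
      (LinearMap.range (LinearMap.funLeft ℝ ℝ fun x => (e.symm x).1)).map
        (dotProductEquiv ℝ I).toLinearMap := by
    ext φ
    obtain ⟨y, rfl⟩ := (dotProductEquiv ℝ I).surjective φ
    rw [Submodule.mem_dualAnnihilator]
    have h1 := forall_mem_vectorSpan_dotProduct_eq_zero_iff hJ y
    rw [h, mem_sInter_normalFan_relabel] at h1
    refine Iff.trans h1 ?_
    rw [Submodule.mem_map]
    constructor
    · intro hy
      refine ⟨y, ⟨fun i => y (e ⟨i, ⟨0, hf i⟩⟩), ?_⟩, rfl⟩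
      ext x
      have hx : e ⟨(e.symm x).1, (e.symm x).2⟩ = x := by simp
      exact (hy _ _ _).trans (congrArg y hx)
    · rintro ⟨_, ⟨u, rfl⟩, hu⟩
      have := (dotProductEquiv ℝ I).injective hu
      subst this
      intro i a b
      simp [LinearMap.funLeft_apply]
  have h2 := Subspace.finrank_add_finrank_dualAnnihilator_eq (vectorSpan ℝ (simplexSum s J))
  rw [key, LinearEquiv.finrank_map_eq, LinearMap.finrank_range_of_inj
    (LinearMap.funLeft_injective_of_surjective ℝ ℝ _ hsurj)] at h2
  simpa [faceDim] using h2

/-! ### The faces of the associahedron -/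

section Dominates

variable {I : Type*} [LinearOrder I]

/-- `y` attains its maximum over the interval spanned by `i` and `j` at `i`. -/
def Dominates (y : I → ℝ) (i j : I) : Prop := ∀ k ∈ Set.uIcc i j, y k ≤ y i

/-- `i` and `j` both dominate each other. -/
def SameBlock (y : I → ℝ) (i j : I) : Prop := Dominates y i j ∧ Dominates y j i

lemma Dominates.trans {y : I → ℝ} {i j k : I} (h1 : Dominates y i j) (h2 : Dominates y j k) :
    Dominates y i k := by
  intro l hl
  have hij : y j ≤ y i := h1 j Set.right_mem_uIcc
  rcases Set.uIcc_subset_uIcc_union_uIcc (b := j) hl with h | h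
  · exact h1 l h
  · exact (h2 l h).trans hij

lemma SameBlock.refl (y : I → ℝ) (i : I) : SameBlock y i i := by
  simp [SameBlock, Dominates]

lemma SameBlock.symm {y : I → ℝ} {i j : I} (h : SameBlock y i j) : SameBlock y j i := ⟨h.2, h.1⟩

lemma SameBlock.trans {y : I → ℝ} {i j k : I} (h1 : SameBlock y i j) (h2 : SameBlock y j k) :
    SameBlock y i k := ⟨h1.1.trans h2.1, h2.2.trans h1.2⟩

lemma SameBlock.eq {y : I → ℝ} {i j : I} (h : SameBlock y i j) : y i = y j :=
  le_antisymm (h.2 i Set.right_mem_uIcc) (h.1 j Set.right_mem_uIcc)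

lemma sameBlock_of_mem_argmaxSet_Icc {y : I → ℝ} {p q i j : I}
    (hi : i ∈ argmaxSet (Set.Icc p q) y) (hj : j ∈ argmaxSet (Set.Icc p q) y) :
    SameBlock y i j := by
  have hsub : Set.uIcc i j ⊆ Set.Icc p q := Set.uIcc_subset_Icc hi.1 hj.1
  refine ⟨fun k hk => hi.2 k (hsub hk), fun k hk => hj.2 k (hsub ?_)⟩
  rwa [Set.uIcc_comm]

/-- The stretches from `k` to `p` and from `k` to `q` cover the interval. Thus the dominance
relation knows all sets of maxima over intervals. -/
lemma mem_argmaxSet_Icc_iff {y : I → ℝ} {p q k : I} :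
    k ∈ argmaxSet (Set.Icc p q) y ↔ k ∈ Set.Icc p q ∧ Dominates y k p ∧ Dominates y k q := by
  constructor
  · rintro ⟨hk, h⟩
    have hp : p ∈ Set.Icc p q := Set.left_mem_Icc.2 (hk.1.trans hk.2)
    have hq : q ∈ Set.Icc p q := Set.right_mem_Icc.2 (hk.1.trans hk.2)
    exact ⟨hk, fun l hl => h l (Set.uIcc_subset_Icc hk hp hl),
      fun l hl => h l (Set.uIcc_subset_Icc hk hq hl)⟩
  · rintro ⟨hk, hp, hq⟩
    refine ⟨hk, fun l hl => ?_⟩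
    rcases le_total l k with h | h
    · exact hp l (Set.mem_uIcc.2 (Or.inr ⟨hl.1, h⟩))
    · exact hq l (Set.mem_uIcc.2 (Or.inl ⟨h, hl.2⟩))

lemma dominates_iff_mem_argmaxSet {y : I → ℝ} {i j : I} :
    Dominates y i j ↔ i ∈ argmaxSet (Set.Icc (min i j) (max i j)) y :=
  ⟨fun h => ⟨Set.left_mem_uIcc, h⟩, fun h => h.2⟩

/-- The intervals of the blocks of `y` are the sets of maxima of `y` over intervals. -/
lemma image_argmaxSet_Icc [Finite I] {y : I → ℝ} {k : ℕ} {f : Fin k → ℕ}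
    (e : (Σ i : Fin k, Fin (f i)) ≃ I) (hmono : ∀ i, StrictMono fun j => e ⟨i, j⟩)
    (hblock : ∀ a b, SameBlock y (e a) (e b) ↔ a.1 = b.1) :
    (fun q : I × I => argmaxSet (Set.Icc q.1 q.2) y) '' {q | q.1 ≤ q.2} =
      (fun q : Σ i : Fin k, Fin (f i) × Fin (f i) =>
        (fun j => e ⟨q.1, j⟩) '' Set.Icc q.2.1 q.2.2) '' {q | q.2.1 ≤ q.2.2} := by
  apply Set.Subset.antisymm
  · rintro _ ⟨⟨p, q⟩, hpq, rfl⟩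
    -- The first and last maxima lie in one block. Since `y` is constant on it, the maxima are
    -- exactly the block elements between them.
    have hne := argmaxSet_nonempty (Set.nonempty_Icc.2 hpq) y
    obtain ⟨p', hp', hmin⟩ := Set.exists_min_image _ id (Set.toFinite _) hne
    obtain ⟨q', hq', hmax⟩ := Set.exists_max_image _ id (Set.toFinite _) hne
    obtain ⟨⟨i, a⟩, rfl⟩ := e.surjective p'
    obtain ⟨⟨i', b⟩, rfl⟩ := e.surjective q'
    obtain rfl : i = i' := (hblock _ _).1 (sameBlock_of_mem_argmaxSet_Icc hp' hq')
    refine ⟨⟨i, a, b⟩, (hmono i).le_iff_le.1 (hmin _ hq'), ?_⟩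
    ext x
    constructor
    · rintro ⟨c, ⟨hac, hcb⟩, rfl⟩
      have hb := (hblock ⟨i, c⟩ ⟨i, a⟩).2 rfl
      refine ⟨⟨hp'.1.1.trans ((hmono i).monotone hac), ((hmono i).monotone hcb).trans hq'.1.2⟩,
        fun l hl => ?_⟩
      rw [hb.eq]
      exact hp'.2 l hl
    · intro hx
      obtain ⟨⟨i', c⟩, rfl⟩ := e.surjective x
      obtain rfl : i = i' := (hblock _ _).1 (sameBlock_of_mem_argmaxSet_Icc hp' hx)
      exact ⟨c, ⟨(hmono i).le_iff_le.1 (hmin _ hx), (hmono i).le_iff_le.1 (hmax _ hx)⟩, rfl⟩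
  · rintro _ ⟨⟨i, a, b⟩, hab, rfl⟩
    have hle : e ⟨i, a⟩ ≤ e ⟨i, b⟩ := (hmono i).monotone hab
    refine ⟨⟨e ⟨i, a⟩, e ⟨i, b⟩⟩, hle, ?_⟩
    have hab' : SameBlock y (e ⟨i, a⟩) (e ⟨i, b⟩) := (hblock _ _).2 rfl
    have ha : e ⟨i, a⟩ ∈ argmaxSet (Set.Icc (e ⟨i, a⟩) (e ⟨i, b⟩)) y := by
      have := hab'.1
      rw [dominates_iff_mem_argmaxSet, min_eq_left hle, max_eq_right hle] at this
      exact this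
    ext x
    constructor
    · intro hx
      obtain ⟨⟨i', c⟩, rfl⟩ := e.surjective x
      obtain rfl : i = i' := (hblock _ _).1 (sameBlock_of_mem_argmaxSet_Icc ha hx)
      exact ⟨c, ⟨(hmono i).le_iff_le.1 hx.1.1, (hmono i).le_iff_le.1 hx.1.2⟩, rfl⟩
    · rintro ⟨c, ⟨hac, hcb⟩, rfl⟩
      refine ⟨⟨(hmono i).monotone hac, (hmono i).monotone hcb⟩, fun l hl => ?_⟩
      rw [((hblock ⟨i, c⟩ ⟨i, a⟩).2 rfl).eq]
      exact ha.2 l hl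

variable [Fintype I]

open Classical in
/-- The block of `i`. -/
def block (y : I → ℝ) (i : I) : Finset I := Finset.univ.filter (SameBlock y i)

open Classical in
/-- The first elements of the blocks of `y`. -/
def blockLeaders (y : I → ℝ) : Finset I :=
  Finset.univ.filter fun i => ∀ j, SameBlock y i j → i ≤ j

/-- The sizes of the blocks of `y`. -/
def blockType (y : I → ℝ) : Multiset ℕ := (blockLeaders y).val.map fun i => (block y i).card

lemma mem_block {y : I → ℝ} {i j : I} : j ∈ block y i ↔ SameBlock y i j := by
  simp [block]

lemma mem_blockLeaders {y : I → ℝ} {i : I} :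
    i ∈ blockLeaders y ↔ ∀ j, SameBlock y i j → i ≤ j := by
  simp [blockLeaders]

lemma exists_blockLeader (y : I → ℝ) (i : I) : ∃ j ∈ blockLeaders y, SameBlock y j i := by
  obtain ⟨j, hj, hmin⟩ := (block y i).exists_min_image id ⟨i, mem_block.2 (SameBlock.refl y i)⟩
  rw [mem_block] at hj
  exact ⟨j, mem_blockLeaders.2 fun l hl => hmin l (mem_block.2 (hj.trans hl)), hj.symm⟩

lemma eq_of_mem_blockLeaders {y : I → ℝ} {i j : I} (hi : i ∈ blockLeaders y)
    (hj : j ∈ blockLeaders y) (h : SameBlock y i j) : i = j :=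
  le_antisymm (mem_blockLeaders.1 hi j h) (mem_blockLeaders.1 hj i h.symm)

/-- Blocks are indexed by their first elements and each is enumerated increasingly, so that
intervals of `Fin (f i)` become intervals inside a block. -/
lemma exists_blockEquiv (y : I → ℝ) : ∃ (k : ℕ) (f : Fin k → ℕ)
    (e : (Σ i : Fin k, Fin (f i)) ≃ I), (∀ i, 1 ≤ f i) ∧
      Multiset.map f Finset.univ.val = blockType y ∧
      (∀ i, StrictMono fun j => e ⟨i, j⟩) ∧
      ∀ a b, SameBlock y (e a) (e b) ↔ a.1 = b.1 := by
  let u := (blockLeaders y).equivFin.symm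
  let f : Fin (blockLeaders y).card → ℕ := fun i => (block y (u i)).card
  let e₀ : (Σ i, Fin (f i)) → I := fun x => (block y (u x.1)).orderEmbOfFin rfl x.2
  have hmem : ∀ x, SameBlock y (u x.1) (e₀ x) :=
    fun x => mem_block.1 (Finset.orderEmbOfFin_mem _ rfl x.2)
  have hblock : ∀ a b, SameBlock y (e₀ a) (e₀ b) ↔ a.1 = b.1 := by
    intro a b
    constructor
    · intro h
      have := eq_of_mem_blockLeaders (u a.1).2 (u b.1).2 (((hmem a).trans h).trans (hmem b).symm)
      exact u.injective (Subtype.ext this)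
    · intro h
      have := hmem a
      rw [h] at this
      exact this.symm.trans (hmem b)
  have hbij : Function.Bijective e₀ := by
    constructor
    · intro a b hab
      have h1 : a.1 = b.1 := (hblock a b).1 (hab ▸ SameBlock.refl y _)
      obtain ⟨i, a⟩ := a
      obtain ⟨j, b⟩ := b
      obtain rfl : i = j := h1
      have : a = b := ((block y (u i)).orderEmbOfFin rfl).injective hab
      rw [this]
    · intro x
      obtain ⟨j, hj, hjx⟩ := exists_blockLeader y x
      have hx : x ∈ block y (u (u.symm ⟨j, hj⟩)) := by
        rw [Equiv.apply_symm_apply]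
        exact mem_block.2 hjx
      have : x ∈ Set.range ((block y (u (u.symm ⟨j, hj⟩))).orderEmbOfFin rfl) := by
        rw [Finset.range_orderEmbOfFin]
        exact hx
      obtain ⟨c, hc⟩ := this
      exact ⟨⟨u.symm ⟨j, hj⟩, c⟩, hc⟩
  refine ⟨_, f, Equiv.ofBijective e₀ hbij, fun i => ?_, ?_, fun i => ?_, hblock⟩
  · exact Finset.card_pos.2 ⟨u i, mem_block.2 (SameBlock.refl y _)⟩
  · have h1 : f = (fun i : blockLeaders y => (block y i).card) ∘ u := rfl
    have h2 : Multiset.map u Finset.univ.val = (blockLeaders y).attach.val :=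
      congrArg Finset.val (Finset.map_univ_equiv u)
    rw [h1, ← Multiset.map_map, h2, blockType]
    exact Multiset.attach_map_val' (blockLeaders y).val fun i => (block y i).card
  · exact ((block y (u i)).orderEmbOfFin rfl).strictMono

end Dominates

/-! ### Types and dimensions of the faces -/

variable {n : ℕ}

lemma nonemptyFaces_stdAssociahedron (n : ℕ) :
    nonemptyFaces (stdAssociahedron n) = Set.range (maxFace (stdAssociahedron n)) :=
  nonemptyFaces_simplexSum Icc_nonempty_of_mem_filter

lemma maxFace_stdAssociahedron_eq_iff (y z : Fin n → ℝ) :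
    maxFace (stdAssociahedron n) y = maxFace (stdAssociahedron n) z ↔
      Dominates y = Dominates z := by
  rw [stdAssociahedron_eq_simplexSum, maxFace_simplexSum_eq_iff Icc_nonempty_of_mem_filter]
  constructor
  · intro h
    ext i j
    rw [dominates_iff_mem_argmaxSet, dominates_iff_mem_argmaxSet]
    exact Set.ext_iff.1 (h (min i j, max i j) (by simp)) i
  · intro h q _
    ext k
    rw [mem_argmaxSet_Icc_iff, mem_argmaxSet_Icc_iff, h]

lemma exists_normalFan_maxFace_stdAssociahedron (y : Fin n → ℝ) :
    ∃ (k : ℕ) (f : Fin k → ℕ) (e : (Σ i : Fin k, Fin (f i)) ≃ Fin n), (∀ i, 1 ≤ f i) ∧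
      Multiset.map f Finset.univ.val = blockType y ∧
      normalFan (maxFace (stdAssociahedron n) y) =
        normalFan (relabel e (associahedronProduct f)) := by
  obtain ⟨k, f, e, hf, hmap, hmono, hblock⟩ := exists_blockEquiv y
  refine ⟨k, f, e, hf, hmap, ?_⟩
  rw [stdAssociahedron_eq_simplexSum, maxFace_simplexSum, relabel_associahedronProduct]
  refine normalFan_simplexSum_congr
    (fun q hq => argmaxSet_nonempty (Icc_nonempty_of_mem_filter q hq) y) ?_
  have := image_argmaxSet_Icc e hmono hblock
  convert this using 2
  · ext q; simp
  · ext q; simp [mem_blockIntervals]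

lemma hasAssociahedralType_maxFace (y : Fin n → ℝ) :
    HasAssociahedralType (maxFace (stdAssociahedron n) y) (blockType y) := by
  obtain ⟨k, f, e, hf, hmap, h⟩ := exists_normalFan_maxFace_stdAssociahedron y
  exact ⟨k, f, hf, hmap, e, h⟩

lemma HasAssociahedralType.unique {F : Set (Fin n → ℝ)} {p q : Multiset ℕ}
    (hp : HasAssociahedralType F p) (hq : HasAssociahedralType F q) : p = q := by
  obtain ⟨k, f, hf, rfl, e, h⟩ := hp
  obtain ⟨k', f', hf', rfl, e', h'⟩ := hq
  exact map_univ_eq_of_normalFan_eq hf hf' e e' (h.symm.trans h')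

lemma associahedralType_maxFace (y : Fin n → ℝ) :
    associahedralType (maxFace (stdAssociahedron n) y) = blockType y := by
  have h : ∃ p, HasAssociahedralType (maxFace (stdAssociahedron n) y) p :=
    ⟨_, hasAssociahedralType_maxFace y⟩
  rw [associahedralType, dif_pos h]
  exact h.choose_spec.unique (hasAssociahedralType_maxFace y)

lemma faceDim_maxFace (y : Fin n → ℝ) :
    faceDim (maxFace (stdAssociahedron n) y) + (blockLeaders y).card = n := by
  obtain ⟨k, f, e, hf, hmap, h⟩ := exists_normalFan_maxFace_stdAssociahedron y
  have hk : (blockLeaders y).card = k := by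
    have := congrArg Multiset.card hmap
    simpa [blockType] using this.symm
  rw [stdAssociahedron_eq_simplexSum, maxFace_simplexSum] at h ⊢
  rw [hk]
  simpa using faceDim_add_card
    (fun q hq => argmaxSet_nonempty (Icc_nonempty_of_mem_filter q hq) y) hf e h

/-- The signed contribution of a face as a product over the blocks. -/
lemma neg_one_pow_mul_faceCoeff {K : Type*} [CommRing K] (c : ℕ → K) (y : Fin n → ℝ) :
    (-1) ^ (n - faceDim (maxFace (stdAssociahedron n) y)) *
      faceCoeff c (maxFace (stdAssociahedron n) y) =
      ∏ i ∈ blockLeaders y, -c (block y i).card := by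
  have h := faceDim_maxFace y
  have h' : n - faceDim (maxFace (stdAssociahedron n) y) = (blockLeaders y).card := by omega
  rw [h', faceCoeff, associahedralType_maxFace, blockType, Multiset.map_map, Finset.prod_neg]
  rfl

/-! ### Counting dominance relations -/

section Counting

open scoped Classical

/-- The dominance relation of `y 0, …, y (n - 1)`. -/
def domOn (n : ℕ) (y : ℕ → ℝ) (i j : ℕ) : Prop :=
  i < n ∧ j < n ∧ ∀ k, (i ≤ k ∧ k ≤ j ∨ j ≤ k ∧ k ≤ i) → y k ≤ y i

lemma finite_range_domOn (n : ℕ) : (Set.range (domOn n)).Finite := by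
  refine (Set.finite_range fun (R : Fin n → Fin n → Prop) (i j : ℕ) =>
    ∃ (hi : i < n) (hj : j < n), R ⟨i, hi⟩ ⟨j, hj⟩).subset ?_
  rintro _ ⟨y, rfl⟩
  refine ⟨fun i j => domOn n y i j, ?_⟩
  ext i j
  exact ⟨fun ⟨_, _, h⟩ => h, fun h => ⟨h.1, h.2.1, h⟩⟩

/-- The dominance relations on `{0, …, n - 1}`. -/
def domRels (n : ℕ) : Finset (ℕ → ℕ → Prop) := (finite_range_domOn n).toFinset

lemma mem_domRels {n : ℕ} {r : ℕ → ℕ → Prop} : r ∈ domRels n ↔ ∃ y, domOn n y = r := by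
  simp [domRels]

/-- The positions of the global maximum. -/
def topBlock (n : ℕ) (r : ℕ → ℕ → Prop) : Finset ℕ :=
  (Finset.range n).filter fun i => ∀ j < n, r i j

variable {n a b : ℕ} {y z : ℕ → ℝ}

lemma mem_topBlock_domOn {i : ℕ} :
    i ∈ topBlock n (domOn n y) ↔ i < n ∧ ∀ j < n, y j ≤ y i := by
  rw [topBlock, Finset.mem_filter, Finset.mem_range]
  simp only [domOn]
  constructor
  · rintro ⟨h1, h2⟩
    exact ⟨h1, fun j hj => (h2 j hj).2.2 j (by omega)⟩
  · rintro ⟨h1, h2⟩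
    exact ⟨h1, fun j hj => ⟨h1, hj, fun k hk => h2 k (by omega)⟩⟩

lemma topBlock_domOn_nonempty (hn : 0 < n) (y : ℕ → ℝ) : (topBlock n (domOn n y)).Nonempty := by
  obtain ⟨i, hi, h⟩ := (Finset.range n).exists_max_image y ⟨0, by simpa using hn⟩
  exact ⟨i, mem_topBlock_domOn.2 ⟨by simpa using hi, fun j hj => h j (by simpa using hj)⟩⟩

/-- The block of `i`. -/
def relBlock (n : ℕ) (r : ℕ → ℕ → Prop) (i : ℕ) : Finset ℕ :=
  (Finset.range n).filter fun j => r i j ∧ r j i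

/-- The restriction of `r` to `{s, …, s + b - 1}`, shifted to start at `0`. -/
def restrictRel (s b : ℕ) (r : ℕ → ℕ → Prop) (i j : ℕ) : Prop :=
  i < b ∧ j < b ∧ r (s + i) (s + j)

/-- Whether `i` dominates `j` depends only on the values between them, so restricting to a window
commutes with forming the relation. -/
lemma restrictRel_domOn {s : ℕ} (h : s + b ≤ n) :
    restrictRel s b (domOn n y) = domOn b fun k => y (s + k) := by
  ext i j
  simp only [restrictRel, domOn]
  constructor
  · rintro ⟨h1, h2, -, -, h3⟩
    exact ⟨h1, h2, fun k hk => h3 (s + k) (by omega)⟩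
  · rintro ⟨h1, h2, h3⟩
    refine ⟨h1, h2, by omega, by omega, fun k hk => ?_⟩
    obtain ⟨l, rfl⟩ : ∃ l, k = s + l := ⟨k - s, by omega⟩
    exact h3 l (by omega)

lemma domOn_add_iff {s i j : ℕ} (h : s + b ≤ n) (hi : i < b) (hj : j < b) :
    domOn n y (s + i) (s + j) ↔ domOn b (fun k => y (s + k)) i j := by
  rw [← restrictRel_domOn h]
  simp [restrictRel, hi, hj]

/-! ### Cutting at the first maximum -/

/-- The first maximum of `y` on `{0, …, a + b}` is at `a`. -/
def IsFirstMax (a b : ℕ) (y : ℕ → ℝ) : Prop :=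
  (∀ i < a, y i < y a) ∧ ∀ k < b, y (a + 1 + k) ≤ y a

/-- The maximum is attained again to the right of `a`. -/
def IsRepeated (a b : ℕ) (y : ℕ → ℝ) : Prop := ∃ k < b, y (a + 1 + k) = y a

lemma IsFirstMax.le (h : IsFirstMax a b y) {i : ℕ} (hi : i < a + 1 + b) : y i ≤ y a := by
  rcases lt_trichotomy i a with h1 | rfl | h1
  · exact (h.1 i h1).le
  · exact le_rfl
  · obtain ⟨k, rfl⟩ : ∃ k, i = a + 1 + k := ⟨i - (a + 1), by omega⟩
    exact h.2 k (by omega)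

lemma IsFirstMax.mem_topBlock (h : IsFirstMax a b y) {i : ℕ} :
    i ∈ topBlock (a + 1 + b) (domOn (a + 1 + b) y) ↔ i < a + 1 + b ∧ y i = y a := by
  rw [mem_topBlock_domOn]
  refine and_congr_right fun hi => ⟨fun h1 => ?_, fun h1 j hj => ?_⟩
  · exact le_antisymm (h.le hi) (h1 a (by omega))
  · rw [h1]
    exact h.le hj

lemma IsFirstMax.mem_topBlock_right (h : IsFirstMax a b y) (hr : IsRepeated a b y) {k : ℕ} :
    k ∈ topBlock b (domOn b fun k => y (a + 1 + k)) ↔ k < b ∧ y (a + 1 + k) = y a := by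
  rw [mem_topBlock_domOn]
  refine and_congr_right fun hk => ⟨fun h1 => ?_, fun h1 j hj => ?_⟩
  · obtain ⟨l, hl, hl'⟩ := hr
    exact le_antisymm (h.2 k hk) (hl' ▸ h1 l hl)
  · rw [h1]
    exact h.2 j hj

lemma IsFirstMax.topBlock_of_repeated (h : IsFirstMax a b y) (hr : IsRepeated a b y) :
    topBlock (a + 1 + b) (domOn (a + 1 + b) y) =
      insert a ((topBlock b (domOn b fun k => y (a + 1 + k))).image (a + 1 + ·)) := by
  ext i
  simp only [h.mem_topBlock, Finset.mem_insert, Finset.mem_image, h.mem_topBlock_right hr]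
  constructor
  · rintro ⟨hi, hi'⟩
    rcases lt_trichotomy i a with h1 | rfl | h1
    · exact absurd hi' (h.1 i h1).ne
    · exact Or.inl rfl
    · obtain ⟨k, rfl⟩ : ∃ k, i = a + 1 + k := ⟨i - (a + 1), by omega⟩
      exact Or.inr ⟨k, ⟨by omega, hi'⟩, rfl⟩
  · rintro (rfl | ⟨k, ⟨hk, hk'⟩, rfl⟩)
    · exact ⟨by omega, rfl⟩
    · exact ⟨by omega, hk'⟩

lemma IsFirstMax.topBlock_of_not_repeated (h : IsFirstMax a b y) (hr : ¬ IsRepeated a b y) :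
    topBlock (a + 1 + b) (domOn (a + 1 + b) y) = {a} := by
  ext i
  simp only [h.mem_topBlock, Finset.mem_singleton]
  constructor
  · rintro ⟨hi, hi'⟩
    rcases lt_trichotomy i a with h1 | rfl | h1
    · exact absurd hi' (h.1 i h1).ne
    · rfl
    · obtain ⟨k, rfl⟩ : ∃ k, i = a + 1 + k := ⟨i - (a + 1), by omega⟩
      exact absurd ⟨k, by omega, hi'⟩ hr
  · rintro rfl
    exact ⟨by omega, rfl⟩

lemma IsFirstMax.card_topBlock_of_repeated (h : IsFirstMax a b y) (hr : IsRepeated a b y) :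
    (topBlock (a + 1 + b) (domOn (a + 1 + b) y)).card =
      (topBlock b (domOn b fun k => y (a + 1 + k))).card + 1 := by
  rw [h.topBlock_of_repeated hr, Finset.card_insert_of_notMem,
    Finset.card_image_of_injective _ (add_right_injective _)]
  simp only [Finset.mem_image, not_exists, not_and]
  intro k _ hk
  omega

/-- The place of the cut can be read off from the relation alone. -/
lemma IsFirstMax.sInf_topBlock (h : IsFirstMax a b y) :
    sInf {i | i ∈ topBlock (a + 1 + b) (domOn (a + 1 + b) y)} = a := by
  refine IsLeast.csInf_eq ⟨h.mem_topBlock.2 ⟨by omega, rfl⟩, fun i hi => ?_⟩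
  by_contra hlt
  exact (h.1 i (by omega)).ne (h.mem_topBlock.1 hi).2

lemma exists_isFirstMax (n : ℕ) (y : ℕ → ℝ) : ∃ a b, a + b = n ∧ IsFirstMax a b y := by
  have hex : ∃ i, i < n + 1 ∧ ∀ j < n + 1, y j ≤ y i := by
    obtain ⟨i, hi⟩ := topBlock_domOn_nonempty (Nat.succ_pos n) y
    exact ⟨i, mem_topBlock_domOn.1 hi⟩
  obtain ⟨h1, h2⟩ := Nat.find_spec hex
  refine ⟨Nat.find hex, n - Nat.find hex, by omega, fun i hi => ?_, fun k hk => h2 _ (by omega)⟩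
  refine lt_of_le_of_ne (h2 i (by omega)) fun heq => Nat.find_min hex hi ⟨by omega, ?_⟩
  rw [heq]
  exact h2

/-- A dominance relation is determined by its parts to the left and to the right of the first
maximum. -/
lemma IsFirstMax.domOn_imp (h : IsFirstMax a b y) (h' : IsFirstMax a b z)
    (hr : IsRepeated a b y ↔ IsRepeated a b z) (h1 : domOn a y = domOn a z)
    (h2 : domOn b (fun k => y (a + 1 + k)) = domOn b fun k => z (a + 1 + k)) {i j : ℕ}
    (hij : domOn (a + 1 + b) y i j) : domOn (a + 1 + b) z i j := by
  obtain ⟨hi, hj, hle⟩ := hij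
  have key : ∀ {w : ℕ → ℝ}, IsFirstMax a b w → w i = w a → domOn (a + 1 + b) w i j := by
    intro w hw hwi
    refine ⟨hi, hj, fun k hk => ?_⟩
    rw [hwi]
    exact hw.le (by omega)
  rcases lt_trichotomy i a with hia | rfl | hia
  -- The strictly larger value at `a` prevents `i` from dominating anything at or beyond `a`.
  · have hja : j < a := by
      by_contra hja
      exact absurd (hle a (by omega)) (not_le.2 (h.1 i hia))
    have : domOn a y i j := ⟨hia, hja, hle⟩
    rw [h1] at this
    exact ⟨hi, hj, this.2.2⟩
  · exact key h' rfl
  · obtain ⟨k, rfl⟩ : ∃ k, i = a + 1 + k := ⟨i - (a + 1), by omega⟩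
    by_cases hja : a < j
    · obtain ⟨l, rfl⟩ : ∃ l, j = a + 1 + l := ⟨j - (a + 1), by omega⟩
      rw [domOn_add_iff (b := b) (by omega) (by omega) (by omega), ← h2,
        ← domOn_add_iff (n := a + 1 + b) (by omega) (by omega) (by omega)]
      exact ⟨hi, hj, hle⟩
    -- The stretch from `i` to `j` contains `a`, so `i` is another global maximum; the top block of
    -- the right part transfers this to `z`.
    · have heq : y (a + 1 + k) = y a := le_antisymm (h.le hi) (hle a (by omega))
      have hry : IsRepeated a b y := ⟨k, by omega, heq⟩
      have hk := (h.mem_topBlock_right hry).2 ⟨by omega, heq⟩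
      rw [h2, h'.mem_topBlock_right (hr.1 hry)] at hk
      exact key h' hk.2

lemma IsFirstMax.domOn_eq (h : IsFirstMax a b y) (h' : IsFirstMax a b z)
    (hr : IsRepeated a b y ↔ IsRepeated a b z) (h1 : domOn a y = domOn a z)
    (h2 : domOn b (fun k => y (a + 1 + k)) = domOn b fun k => z (a + 1 + k)) :
    domOn (a + 1 + b) y = domOn (a + 1 + b) z := by
  ext i j
  exact ⟨h.domOn_imp h' hr h1 h2, h'.domOn_imp h hr.symm h1.symm h2.symm⟩

lemma domOn_congr_sub_const {C : ℝ} (h : ∀ k < n, y k = z k - C) : domOn n y = domOn n z := by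
  ext i j
  refine and_congr_right fun hi => and_congr_right fun hj => forall_congr' fun k => ?_
  refine imp_congr_right fun hk => ?_
  rw [h k (by omega), h i hi, sub_le_sub_iff_right]

lemma exists_forall_lt (n : ℕ) (y : ℕ → ℝ) : ∃ C, ∀ k < n, y k < C := by
  obtain ⟨M, hM⟩ := ((Finset.range n).image y).bddAbove
  exact ⟨M + 1, fun k hk => lt_of_le_of_lt
    (hM (Finset.mem_coe.2 (Finset.mem_image_of_mem y (Finset.mem_range.2 hk)))) (lt_add_one M)⟩

/-- Gluing of dominance relations. -/
lemma exists_glue (a b : ℕ) (y z : ℕ → ℝ) (p : Prop) (hb : p → 0 < b) :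
    ∃ w, IsFirstMax a b w ∧ (IsRepeated a b w ↔ p) ∧ domOn a w = domOn a y ∧
      domOn b (fun k => w (a + 1 + k)) = domOn b z := by
  obtain ⟨C₁, hC₁⟩ := exists_forall_lt a y
  -- Lowering `z` by `C₂` puts its maximum level with the value 0 at `a` if `p` holds, and strictly
  -- below it otherwise.
  obtain ⟨C₂, hC₂, hp⟩ : ∃ C, (∀ k < b, z k ≤ C) ∧ ((∃ k < b, z k = C) ↔ p) := by
    by_cases hp : p
    · obtain ⟨i, hi⟩ := topBlock_domOn_nonempty (hb hp) z
      rw [mem_topBlock_domOn] at hi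
      exact ⟨z i, hi.2, iff_of_true ⟨i, hi.1, rfl⟩ hp⟩
    · obtain ⟨C, hC⟩ := exists_forall_lt b z
      exact ⟨C, fun k hk => (hC k hk).le,
        iff_of_false (fun ⟨k, hk, h⟩ => (hC k hk).ne h) hp⟩
  let w : ℕ → ℝ := fun k => if k < a then y k - C₁ else if k = a then 0 else z (k - (a + 1)) - C₂
  have hw1 : ∀ k < a, w k = y k - C₁ := fun k hk => if_pos hk
  have hw2 : w a = 0 := by simp [w]
  have hw3 : ∀ k, w (a + 1 + k) = z k - C₂ := by
    intro k
    have h1 : ¬ a + 1 + k < a := by omega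
    have h2 : ¬ a + 1 + k = a := by omega
    simp [w, h1, h2]
  refine ⟨w, ⟨fun i hi => ?_, fun k hk => ?_⟩, ?_, domOn_congr_sub_const hw1,
    domOn_congr_sub_const fun k _ => hw3 k⟩
  · rw [hw1 i hi, hw2]
    linarith [hC₁ i hi]
  · rw [hw3, hw2]
    linarith [hC₂ k hk]
  · simp only [IsRepeated, hw3, hw2, sub_eq_zero]
    exact hp

/-! ### Weighted counts and their recursion -/

variable {K : Type*} [CommRing K] (c : ℕ → K)

/-- The contribution of `i`: it is `-c` of the size of the block of `i` if `i` is the first element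
of its block. -/
def leaderWeight (n : ℕ) (r : ℕ → ℕ → Prop) (i : ℕ) : K :=
  if ∀ j < i, ¬ (r i j ∧ r j i) then -c (relBlock n r i).card else 1

/-- The product of the contributions of the blocks, except the top one if `0 < f`. -/
def relWeight (f n : ℕ) (r : ℕ → ℕ → Prop) : K :=
  ∏ i ∈ Finset.range n, if 0 < f ∧ i ∈ topBlock n r then 1 else leaderWeight c n r i

/-- The dominance relations with top block of size `f`, or all of them if `f = 0`. -/
def domRelsTop (f n : ℕ) : Finset (ℕ → ℕ → Prop) :=
  (domRels n).filter fun r => 0 < f → (topBlock n r).card = f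

/-- The weighted number of dominance relations with top block of size `f`, of all of them if
`f = 0`. -/
def relSum (f n : ℕ) : K := ∑ r ∈ domRelsTop f n, relWeight c f n r

lemma mem_domRelsTop {f : ℕ} {r : ℕ → ℕ → Prop} :
    r ∈ domRelsTop f n ↔ r ∈ domRels n ∧ (0 < f → (topBlock n r).card = f) := by
  simp [domRelsTop]

lemma relSum_succ_zero (f : ℕ) : relSum c (f + 1) 0 = 0 := by
  refine Finset.sum_eq_zero fun r hr => ?_
  have := (mem_domRelsTop.1 hr).2 (Nat.succ_pos f)
  simp [topBlock] at this

lemma relSum_zero_zero : relSum c 0 0 = 1 := by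
  have h : domRelsTop 0 0 = {fun _ _ => False} := by
    ext r
    rw [mem_domRelsTop, mem_domRels, Finset.mem_singleton]
    have h0 : ∀ y, domOn 0 y = fun _ _ => False := by
      intro y
      ext i j
      simp [domOn]
    simp [h0, eq_comm]
  rw [relSum, h]
  simp [relWeight]

/-- The strict peak at `a` confines the block of `i` to the left part. -/
lemma leaderWeight_left (h : IsFirstMax a b y) {i : ℕ} (hi : i < a) :
    leaderWeight c (a + 1 + b) (domOn (a + 1 + b) y) i = leaderWeight c a (domOn a y) i := by
  have key : ∀ j, (domOn (a + 1 + b) y i j ∧ domOn (a + 1 + b) y j i) ↔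
      (domOn a y i j ∧ domOn a y j i) := by
    intro j
    constructor
    · rintro ⟨h1, h2⟩
      have hja : j < a := by
        by_contra hja
        exact absurd (h1.2.2 a (by omega)) (not_le.2 (h.1 i hi))
      exact ⟨⟨hi, hja, h1.2.2⟩, ⟨hja, hi, h2.2.2⟩⟩
    · rintro ⟨⟨h1, h2, h3⟩, ⟨h4, h5, h6⟩⟩
      exact ⟨⟨by omega, by omega, h3⟩, ⟨by omega, by omega, h6⟩⟩
  have hblock : relBlock (a + 1 + b) (domOn (a + 1 + b) y) i = relBlock a (domOn a y) i := by
    ext j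
    simp only [relBlock, Finset.mem_filter, Finset.mem_range, key]
    exact ⟨fun h => ⟨h.2.1.2.1, h.2⟩, fun h => ⟨by omega, h.2⟩⟩
  simp only [leaderWeight, key, hblock]

lemma leaderWeight_right {k : ℕ} (hk : k < b) (hlt : y (a + 1 + k) < y a) :
    leaderWeight c (a + 1 + b) (domOn (a + 1 + b) y) (a + 1 + k) =
      leaderWeight c b (domOn b fun k => y (a + 1 + k)) k := by
  have key : ∀ l < b, (domOn (a + 1 + b) y (a + 1 + k) (a + 1 + l) ∧
      domOn (a + 1 + b) y (a + 1 + l) (a + 1 + k)) ↔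
      (domOn b (fun k => y (a + 1 + k)) k l ∧ domOn b (fun k => y (a + 1 + k)) l k) := by
    intro l hl
    rw [domOn_add_iff (by omega) hk hl, domOn_add_iff (by omega) hl hk]
  have hfalse : ∀ j ≤ a, ¬ domOn (a + 1 + b) y (a + 1 + k) j := by
    intro j hj hd
    exact absurd (hd.2.2 a (by omega)) (not_le.2 hlt)
  have hblock : relBlock (a + 1 + b) (domOn (a + 1 + b) y) (a + 1 + k) =
      (relBlock b (domOn b fun k => y (a + 1 + k)) k).image (a + 1 + ·) := by
    ext j
    simp only [relBlock, Finset.mem_filter, Finset.mem_range, Finset.mem_image]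
    constructor
    · rintro ⟨hj, hd⟩
      have : ¬ j ≤ a := fun hja => hfalse j hja hd.1
      obtain ⟨l, rfl⟩ : ∃ l, j = a + 1 + l := ⟨j - (a + 1), by omega⟩
      exact ⟨l, ⟨by omega, (key l (by omega)).1 hd⟩, rfl⟩
    · rintro ⟨l, ⟨hl, hd⟩, rfl⟩
      exact ⟨by omega, (key l hl).2 hd⟩
  have hlead : (∀ j < a + 1 + k, ¬ (domOn (a + 1 + b) y (a + 1 + k) j ∧
      domOn (a + 1 + b) y j (a + 1 + k))) ↔
      ∀ l < k, ¬ (domOn b (fun k => y (a + 1 + k)) k l ∧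
        domOn b (fun k => y (a + 1 + k)) l k) := by
    constructor
    · intro hd l hl
      rw [← key l (by omega)]
      exact hd _ (by omega)
    · rintro hd j hj ⟨h1, h2⟩
      have : ¬ j ≤ a := fun hja => hfalse j hja h1
      obtain ⟨l, rfl⟩ : ∃ l, j = a + 1 + l := ⟨j - (a + 1), by omega⟩
      exact hd l (by omega) ((key l (by omega)).1 ⟨h1, h2⟩)
  simp only [leaderWeight, hlead, hblock, Finset.card_image_of_injective _ (add_right_injective _)]

/-- The omitted top block is `a` together with any repetitions on the right. By `hf`, the right
factor omits its own top block exactly when that block merges with `a`; all other blocks lie on one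
side of `a`. -/
lemma relWeight_succ (h : IsFirstMax a b y) {f : ℕ} (hf : 0 < f ↔ IsRepeated a b y) :
    relWeight c (f + 1) (a + 1 + b) (domOn (a + 1 + b) y) =
      relWeight c 0 a (domOn a y) * relWeight c f b (domOn b fun k => y (a + 1 + k)) := by
  rw [relWeight, Finset.prod_range_add, Finset.prod_range_succ, relWeight, relWeight]
  have ha : a ∈ topBlock (a + 1 + b) (domOn (a + 1 + b) y) :=
    h.mem_topBlock.2 ⟨by omega, rfl⟩
  rw [if_pos ⟨Nat.succ_pos f, ha⟩, mul_one]
  congr 1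
  · refine Finset.prod_congr rfl fun i hi => ?_
    have hia : i < a := Finset.mem_range.1 hi
    rw [if_neg (fun hi => (h.1 i hia).ne (h.mem_topBlock.1 hi.2).2), if_neg (by simp),
      leaderWeight_left c h hia]
  · refine Finset.prod_congr rfl fun k hk => ?_
    have hkb : k < b := Finset.mem_range.1 hk
    by_cases heq : y (a + 1 + k) = y a
    · have hr : IsRepeated a b y := ⟨k, hkb, heq⟩
      rw [if_pos ⟨Nat.succ_pos f, h.mem_topBlock.2 ⟨by omega, heq⟩⟩,
        if_pos ⟨hf.2 hr, (h.mem_topBlock_right hr).2 ⟨hkb, heq⟩⟩]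
    · rw [if_neg (fun hi => heq (h.mem_topBlock.1 hi.2).2),
        if_neg (fun hi => heq ((h.mem_topBlock_right (hf.1 hi.1)).1 hi.2).2),
        leaderWeight_right c hkb (lt_of_le_of_ne (h.2 k hkb) heq)]

lemma mem_domRelsTop_iff_of_isFirstMax (h : IsFirstMax a b y) (f : ℕ) :
    domOn (a + 1 + b) y ∈ domRelsTop (f + 1) (a + 1 + b) ↔
      (0 < f ↔ IsRepeated a b y) ∧ domOn b (fun k => y (a + 1 + k)) ∈ domRelsTop f b := by
  simp only [mem_domRelsTop, mem_domRels, exists_apply_eq_apply, true_and, Nat.succ_pos,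
    true_imp_iff]
  by_cases hr : IsRepeated a b y
  · rw [h.card_topBlock_of_repeated hr]
    obtain ⟨k, hk, hk'⟩ := hr
    have hpos := Finset.card_pos.2
      (topBlock_domOn_nonempty (n := b) (by omega) fun k => y (a + 1 + k))
    have hr : IsRepeated a b y := ⟨k, hk, hk'⟩
    simp only [hr, iff_true]
    omega
  · rw [h.topBlock_of_not_repeated hr]
    simp only [hr, iff_false, Finset.card_singleton]
    omega

/-- Decomposition of dominance relations at the first maximum. -/
lemma relSum_succ_succ (f n : ℕ) :
    relSum c (f + 1) (n + 1) =
      ∑ p ∈ Finset.HasAntidiagonal.antidiagonal n, relSum c 0 p.1 * relSum c f p.2 := by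
  simp only [relSum, Finset.sum_mul_sum, ← Finset.sum_product']
  rw [Finset.sum_sigma']
  let cut : (ℕ → ℕ → Prop) → ℕ := fun r => sInf {i | i ∈ topBlock (n + 1) r}
  -- The bijection drops the first maximum and keeps the two sides. For `f = 0` the right side is
  -- arbitrary and lies strictly below the maximum.
  let parts : (ℕ → ℕ → Prop) → Σ _ : ℕ × ℕ, (ℕ → ℕ → Prop) × (ℕ → ℕ → Prop) := fun r =>
    ⟨(cut r, n - cut r), (restrictRel 0 (cut r) r, restrictRel (cut r + 1) (n - cut r) r)⟩
  have hparts : ∀ a b y, a + b = n → IsFirstMax a b y → parts (domOn (n + 1) y) =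
      ⟨(a, b), (domOn a y, domOn b fun k => y (a + 1 + k))⟩ := by
    rintro a b y rfl h
    have hn : a + b + 1 = a + 1 + b := by omega
    have hcut : cut (domOn (a + b + 1) y) = a := by
      simp only [cut, hn]
      exact h.sInf_topBlock
    simp only [parts, hcut, Nat.add_sub_cancel_left]
    rw [restrictRel_domOn (by omega), restrictRel_domOn (by omega)]
    simp
  refine Finset.sum_bij (fun r _ => parts r) ?_ ?_ ?_ ?_
  · intro r hr
    obtain ⟨y, rfl⟩ := mem_domRels.1 (mem_domRelsTop.1 hr).1
    obtain ⟨a, b, rfl, h⟩ := exists_isFirstMax n y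
    rw [show a + b + 1 = a + 1 + b by omega, mem_domRelsTop_iff_of_isFirstMax h] at hr
    rw [hparts a b y rfl h]
    simp only [Finset.mem_sigma, Finset.HasAntidiagonal.mem_antidiagonal, Finset.mem_product, true_and]
    exact ⟨mem_domRelsTop.2 ⟨mem_domRels.2 ⟨y, rfl⟩, by simp⟩, hr.2⟩
  · intro r hr r' hr' heq
    obtain ⟨y, rfl⟩ := mem_domRels.1 (mem_domRelsTop.1 hr).1
    obtain ⟨z, rfl⟩ := mem_domRels.1 (mem_domRelsTop.1 hr').1
    obtain ⟨a, b, rfl, h⟩ := exists_isFirstMax n y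
    obtain ⟨a', b', hab, h'⟩ := exists_isFirstMax (a + b) z
    rw [hparts a b y rfl h, hparts a' b' z hab h'] at heq
    simp only [Sigma.mk.injEq, Prod.mk.injEq, heq_eq_eq] at heq
    obtain ⟨⟨rfl, rfl⟩, h1, h2⟩ := heq
    rw [show a + b + 1 = a + 1 + b by omega] at hr hr' ⊢
    rw [mem_domRelsTop_iff_of_isFirstMax h] at hr
    rw [mem_domRelsTop_iff_of_isFirstMax h'] at hr'
    exact h.domOn_eq h' (hr.1.symm.trans hr'.1) h1 h2
  · rintro ⟨⟨a, b⟩, ⟨r₁, r₂⟩⟩ hx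
    simp only [Finset.mem_sigma, Finset.HasAntidiagonal.mem_antidiagonal, Finset.mem_product] at hx
    obtain ⟨rfl, h1, h2⟩ := hx
    obtain ⟨y, rfl⟩ := mem_domRels.1 (mem_domRelsTop.1 h1).1
    obtain ⟨z, rfl⟩ := mem_domRels.1 (mem_domRelsTop.1 h2).1
    -- An empty right part has an empty top block, so `0 < f` forces `0 < b`.
    obtain ⟨w, hw, hr, hl, hr'⟩ := exists_glue a b y z (0 < f) (by
      intro hf
      by_contra hb
      obtain rfl : b = 0 := by omega
      have := (mem_domRelsTop.1 h2).2 hf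
      simp only [topBlock, Finset.range_zero, Finset.filter_empty, Finset.card_empty] at this
      omega)
    refine ⟨domOn (a + b + 1) w, ?_, ?_⟩
    · rw [show a + b + 1 = a + 1 + b by omega, mem_domRelsTop_iff_of_isFirstMax hw, hr']
      exact ⟨hr.symm, h2⟩
    · rw [hparts a b w rfl hw, hl, hr']
  · intro r hr
    obtain ⟨y, rfl⟩ := mem_domRels.1 (mem_domRelsTop.1 hr).1
    obtain ⟨a, b, rfl, h⟩ := exists_isFirstMax n y
    rw [hparts a b y rfl h]
    rw [show a + b + 1 = a + 1 + b by omega] at hr ⊢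
    rw [mem_domRelsTop_iff_of_isFirstMax h] at hr
    exact relWeight_succ c h hr.1

/-- Within the top block only its first element has a nontrivial weight, namely `-c f`. -/
lemma relWeight_zero_eq (hn : 0 < n) (y : ℕ → ℝ) {f : ℕ}
    (hf : (topBlock n (domOn n y)).card = f) :
    relWeight c 0 n (domOn n y) = -c f * relWeight c f n (domOn n y) := by
  have hne := topBlock_domOn_nonempty hn y
  have hfpos : 0 < f := hf ▸ Finset.card_pos.2 hne
  have hsub : topBlock n (domOn n y) ⊆ Finset.range n := Finset.filter_subset _ _
  have hsame : ∀ i ∈ topBlock n (domOn n y), ∀ j, (domOn n y i j ∧ domOn n y j i) ↔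
      j ∈ topBlock n (domOn n y) := by
    intro i hi j
    rw [mem_topBlock_domOn] at hi ⊢
    constructor
    · rintro ⟨h1, h2⟩
      exact ⟨h1.2.1, fun l hl => (hi.2 l hl).trans (h2.2.2 i (by omega))⟩
    · rintro ⟨hj, hj'⟩
      exact ⟨⟨hi.1, hj, fun k hk => hi.2 k (by omega)⟩, ⟨hj, hi.1, fun k hk => hj' k (by omega)⟩⟩
  have hblock : ∀ i ∈ topBlock n (domOn n y), relBlock n (domOn n y) i = topBlock n (domOn n y) := by
    intro i hi
    ext j
    simp only [relBlock, Finset.mem_filter, hsame i hi, and_iff_right_iff_imp]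
    exact fun hj => hsub hj
  simp only [relWeight, hfpos, lt_irrefl, false_and, true_and, if_false]
  rw [← Finset.prod_sdiff hsub, ← Finset.prod_sdiff hsub, mul_comm]
  have h1 : ∏ i ∈ topBlock n (domOn n y), leaderWeight c n (domOn n y) i = -c f := by
    obtain ⟨m, hm, hmin⟩ := (topBlock n (domOn n y)).exists_min_image id hne
    rw [Finset.prod_eq_single_of_mem m hm, leaderWeight, if_pos, hblock m hm, hf]
    · intro j hj
      rw [hsame m hm]
      exact fun h => absurd (hmin j h) (not_le.2 hj)
    · intro i hi him
      rw [leaderWeight, if_neg]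
      intro h
      exact h m (lt_of_le_of_ne (hmin i hi) him.symm) ((hsame i hi m).2 hm)
  have h2 : ∏ i ∈ topBlock n (domOn n y), (if i ∈ topBlock n (domOn n y) then (1 : K)
      else leaderWeight c n (domOn n y) i) = 1 :=
    Finset.prod_eq_one fun i hi => if_pos hi
  rw [h1, h2, mul_one]
  congr 1
  exact Finset.prod_congr rfl fun i hi => (if_neg (Finset.mem_sdiff.1 hi).2).symm

lemma relSum_zero_eq (hn : 0 < n) :
    relSum c 0 n = -∑ f ∈ Finset.range n, c (f + 1) * relSum c (f + 1) n := by
  have h0 : domRelsTop 0 n = domRels n := by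
    ext r
    simp [mem_domRelsTop]
  rw [relSum, h0, ← Finset.sum_fiberwise_of_maps_to (t := Finset.range n)
    -- For `0 < n` the top block has between 1 and `n` elements, hence the shift by one.
    (g := fun r => (topBlock n r).card - 1), ← Finset.sum_neg_distrib]
  · refine Finset.sum_congr rfl fun f _ => ?_
    rw [relSum, Finset.mul_sum, ← Finset.sum_neg_distrib]
    refine Finset.sum_congr ?_ ?_
    · ext r
      rw [Finset.mem_filter, mem_domRelsTop]
      refine and_congr_right fun hr => ?_
      obtain ⟨y, rfl⟩ := mem_domRels.1 hr
      have := Finset.card_pos.2 (topBlock_domOn_nonempty hn y)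
      omega
    · intro r hr
      rw [mem_domRelsTop] at hr
      obtain ⟨y, rfl⟩ := mem_domRels.1 hr.1
      rw [relWeight_zero_eq c hn y (hr.2 (Nat.succ_pos f)), neg_mul]
  · intro r hr
    have : (topBlock n r).card ≤ n := by
      simpa [topBlock] using Finset.card_filter_le (Finset.range n) fun i => ∀ j < n, r i j
    rw [Finset.mem_range]
    omega

/-! ### The face sum of the associahedron -/

lemma dominates_iff_domOn (y : ℕ → ℝ) (i j : Fin n) :
    Dominates (fun k : Fin n => y k) i j ↔ domOn n y i j := by
  simp only [Dominates, domOn, i.2, j.2, true_and, Set.mem_uIcc, Fin.le_def]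
  exact ⟨fun h k hk => h ⟨k, by omega⟩ hk, fun h k hk => h k hk⟩

lemma domOn_eq_iff (y z : ℕ → ℝ) : domOn n y = domOn n z ↔
    Dominates (fun k : Fin n => y k) = Dominates fun k : Fin n => z k := by
  constructor
  · intro h
    ext i j
    rw [dominates_iff_domOn, dominates_iff_domOn, h]
  · intro h
    ext i j
    by_cases hij : i < n ∧ j < n
    · exact (dominates_iff_domOn y ⟨i, hij.1⟩ ⟨j, hij.2⟩).symm.trans
        (h ▸ dominates_iff_domOn z ⟨i, hij.1⟩ ⟨j, hij.2⟩)
    · exact iff_of_false (fun h => hij ⟨h.1, h.2.1⟩) (fun h => hij ⟨h.1, h.2.1⟩)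

lemma prod_blockLeaders_eq_relWeight (y : ℕ → ℝ) :
    ∏ i ∈ blockLeaders (fun k : Fin n => y k), -c (block (fun k : Fin n => y k) i).card =
      relWeight c 0 n (domOn n y) := by
  simp only [relWeight, lt_irrefl, false_and, if_false]
  rw [← Fin.prod_univ_eq_prod_range, blockLeaders, Finset.prod_filter]
  refine Finset.prod_congr rfl fun i _ => ?_
  have hsame : ∀ j : Fin n, SameBlock (fun k : Fin n => y k) i j ↔
      (domOn n y i j ∧ domOn n y j i) := by
    intro j
    rw [SameBlock, dominates_iff_domOn, dominates_iff_domOn]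
  have hcard : (block (fun k : Fin n => y k) i).card = (relBlock n (domOn n y) i).card := by
    rw [← Finset.card_map Fin.valEmbedding]
    congr 1
    ext j
    simp only [Finset.mem_map, mem_block, hsame, relBlock, Finset.mem_filter, Finset.mem_range,
      Fin.valEmbedding_apply]
    exact ⟨by rintro ⟨j, hj, rfl⟩; exact ⟨j.2, hj⟩, fun ⟨hj, h⟩ => ⟨⟨j, hj⟩, h, rfl⟩⟩
  have hlead : (∀ j, SameBlock (fun k : Fin n => y k) i j → i ≤ j) ↔
      ∀ j < (i : ℕ), ¬ (domOn n y i j ∧ domOn n y j i) := by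
    simp only [hsame]
    constructor
    · intro h j hj hd
      exact absurd (h ⟨j, by omega⟩ hd) (not_le.2 hj)
    · intro h j hd
      by_contra hlt
      exact h j (not_le.1 hlt) hd
  rw [leaderWeight, hcard]
  by_cases h : ∀ j, SameBlock (fun k : Fin n => y k) i j → i ≤ j
  · rw [if_pos h, if_pos (hlead.1 h)]
  · rw [if_neg h, if_neg fun h' => h (hlead.2 h')]

lemma associahedronFaceSum_eq_relSum (n : ℕ) : associahedronFaceSum c n = relSum c 0 n := by
  have h0 : (domRelsTop 0 n : Set (ℕ → ℕ → Prop)) = Set.range (domOn n) := by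
    ext r
    simp [mem_domRelsTop, mem_domRels]
  -- Any function realizing `r` may be chosen: the face depends only on the relation.
  let face : (ℕ → ℕ → Prop) → Set (Fin n → ℝ) := fun r =>
    maxFace (stdAssociahedron n) fun k => Function.invFun (domOn n) r k
  have hface : ∀ y, face (domOn n y) = maxFace (stdAssociahedron n) fun k => y k := by
    intro y
    rw [maxFace_stdAssociahedron_eq_iff, ← domOn_eq_iff]
    exact Function.invFun_eq ⟨y, rfl⟩
  rw [associahedronFaceSum, relSum, ← finsum_mem_coe_finset]
  symm
  refine finsum_mem_eq_of_bijOn face ?_ ?_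
  · rw [h0, nonemptyFaces_stdAssociahedron]
    refine ⟨?_, ?_, ?_⟩
    · rintro _ ⟨y, rfl⟩
      exact ⟨_, (hface y).symm⟩
    · rintro _ ⟨y, rfl⟩ _ ⟨z, rfl⟩ h
      rwa [hface, hface, maxFace_stdAssociahedron_eq_iff, ← domOn_eq_iff] at h
    · rintro _ ⟨y, rfl⟩
      let y' : ℕ → ℝ := fun k => if h : k < n then y ⟨k, h⟩ else 0
      refine ⟨domOn n y', ⟨y', rfl⟩, ?_⟩
      rw [hface]
      congr 1
      ext k
      simp [y']
  · intro r hr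
    rw [h0] at hr
    obtain ⟨y, rfl⟩ := hr
    rw [hface, neg_one_pow_mul_faceCoeff, prod_blockLeaders_eq_relWeight]

end Counting

/-! ### The compositional inverse -/

section Inverse

open PowerSeries

variable {K : Type*} [CommRing K] (c : ℕ → K)

lemma constantCoeff_tangentSeries : constantCoeff (tangentSeries c) = 0 := by
  simp [tangentSeries, ← coeff_zero_eq_constantCoeff_apply]

lemma coeff_one_tangentSeries : coeff 1 (tangentSeries c) = 1 := by
  simp [tangentSeries]

lemma mk_relSum_eq (f : ℕ) :
    PowerSeries.mk (relSum c f) = X ^ f * PowerSeries.mk (relSum c 0) ^ (f + 1) := by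
  induction f with
  | zero => simp
  | succ f ih =>
    have : PowerSeries.mk (relSum c (f + 1)) =
        X * (PowerSeries.mk (relSum c 0) * PowerSeries.mk (relSum c f)) := by
      ext n
      cases n with
      | zero => simp [relSum_succ_zero]
      | succ n => rw [coeff_succ_X_mul, coeff_mul, coeff_mk, relSum_succ_succ]; simp
    rw [this, ih]
    ring

lemma tangentSeries_relSum : tangentSeries (relSum c 0) = X * PowerSeries.mk (relSum c 0) := by
  ext n
  rcases n with _ | _ | n
  · simp [tangentSeries]
  · simp [tangentSeries, coeff_succ_X_mul, relSum_zero_zero]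
  · simp [tangentSeries, coeff_succ_X_mul]

/-- This is `D^{f+1} = x S_f`: powers of the candidate inverse count relations by the size of their
top block. -/
lemma coeff_tangentSeries_relSum_pow (n f : ℕ) :
    coeff (n + 1) (tangentSeries (relSum c 0) ^ (f + 1)) = relSum c f n := by
  have : tangentSeries (relSum c 0) ^ (f + 1) = X * PowerSeries.mk (relSum c f) := by
    rw [tangentSeries_relSum, mk_relSum_eq c f]
    ring
  rw [this, coeff_succ_X_mul, coeff_mk]

lemma relSum_eq_zero_of_lt {f n : ℕ} (h : n < f) : relSum c f n = 0 := by
  rw [← coeff_mk n (relSum c f), mk_relSum_eq, coeff_X_pow_mul', if_neg (by omega)]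

lemma subst_tangentSeries_relSum :
    PowerSeries.subst (tangentSeries (relSum c 0)) (tangentSeries c) = (X : PowerSeries K) := by
  have h0 := constantCoeff_tangentSeries (relSum c 0)
  ext n
  rw [coeff_subst' (HasSubst.of_constantCoeff_zero' h0)]
  rcases n with _ | n
  · rw [finsum_eq_zero_of_forall_eq_zero]
    · simp
    · rintro (_ | d)
      · simp [tangentSeries]
      · simp [h0]
  · rw [finsum_eq_sum_of_support_subset (s := Finset.range (n + 2))]
    · have hterm : ∀ f, coeff (f + 2) (tangentSeries c) •
          coeff (n + 1) (tangentSeries (relSum c 0) ^ (f + 2)) =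
          c (f + 1) * relSum c (f + 1) n := by
        intro f
        rw [coeff_tangentSeries_relSum_pow c n (f + 1)]
        simp [tangentSeries]
      -- Degree 0 contributes nothing and degree 1 gives `relSum c 0 n`; the remaining `n` degrees
      -- form the sum in `relSum_zero_eq`.
      rw [Finset.sum_range_succ', Finset.sum_range_succ']
      simp only [hterm, add_assoc, Nat.reduceAdd, zero_add, coeff_one_tangentSeries,
        coeff_tangentSeries_relSum_pow c n 0]
      rcases Nat.eq_zero_or_pos n with rfl | hn
      · simp [relSum_zero_zero, tangentSeries]
      · rw [relSum_zero_eq c hn, coeff_X, if_neg (by omega)]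
        simp [tangentSeries]
    · intro d hd
      rw [Finset.coe_range, Set.mem_Iio]
      by_contra hlt
      obtain ⟨f, rfl⟩ : ∃ f, d = f + 1 := ⟨d - 1, by omega⟩
      exact hd (by simp [coeff_tangentSeries_relSum_pow,
        relSum_eq_zero_of_lt c (show n < f by omega)])

end Inverse

/-- Associativity: `D(C(E))` is `E` because `D(C) = x`, and `D` because `C(E) = x`. -/
lemma IsCompositionalInverse.eq_of_subst_eq_X {K : Type*} [CommRing K] {C D E : PowerSeries K}
    (hD : IsCompositionalInverse C D) (hE : PowerSeries.constantCoeff E = 0)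
    (h : PowerSeries.subst E C = PowerSeries.X) : E = D := by
  obtain ⟨hC, hD0, -, hDC⟩ := hD
  have hC' := PowerSeries.HasSubst.of_constantCoeff_zero' hC
  have hE' := PowerSeries.HasSubst.of_constantCoeff_zero' hE
  have := PowerSeries.subst_comp_subst_apply hC' hE' D
  rw [hDC, PowerSeries.subst_X hE'] at this
  exact this.trans ((congrArg (fun G => PowerSeries.subst G D) h).trans (PowerSeries.X_subst D))

lemma isCompositionalInverse_substInvOfIsUnit {K : Type*} [CommRing K] {C : PowerSeries K}
    (h0 : PowerSeries.constantCoeff C = 0) (h1 : IsUnit (PowerSeries.coeff 1 C)) :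
    IsCompositionalInverse C (C.substInvOfIsUnit h1) :=
  ⟨h0, by simp, C.subst_substInvOfIsUnit_right h0 h1, C.subst_substInvOfIsUnit_left h0 h1⟩

end

theorem theorem11p3 {K : Type*} [Field K] [CharZero K] (c : ℕ → K) :
    (∀ n : ℕ, 1 ≤ n →
      (nonemptyFaces (stdAssociahedron n)).Finite ∧
      ∀ F ∈ nonemptyFaces (stdAssociahedron n), ∃! p : Multiset ℕ, HasAssociahedralType F p) ∧
    ∀ D : PowerSeries K,
      IsCompositionalInverse (tangentSeries c) D ↔
        D = tangentSeries (fun n => associahedronFaceSum c n) := by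
  refine ⟨fun n _ => ⟨finite_nonemptyFaces_simplexSum, fun F hF => ?_⟩, fun D => ?_⟩
  · rw [nonemptyFaces_stdAssociahedron] at hF
    obtain ⟨y, rfl⟩ := hF
    exact ⟨_, hasAssociahedralType_maxFace y, fun p hp => hp.unique (hasAssociahedralType_maxFace y)⟩
  · simp only [associahedronFaceSum_eq_relSum]
    have h0 := constantCoeff_tangentSeries (relSum c 0)
    have hsubst := subst_tangentSeries_relSum c
    -- Some two-sided inverse exists because the linear coefficient is 1; the face series, being a
    -- right inverse, coincides with it.
    have hinv := isCompositionalInverse_substInvOfIsUnit (constantCoeff_tangentSeries c)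
      ((coeff_one_tangentSeries c).symm ▸ isUnit_one)
    constructor
    · intro hD
      exact (hD.eq_of_subst_eq_X h0 hsubst).symm
    · rintro rfl
      have := hinv.eq_of_subst_eq_X h0 hsubst
      rw [show (fun n => relSum c 0 n) = relSum c 0 from rfl, this]
      exact hinv
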